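/- Let $D\subset\mathbb R^2$ be an unbounded domain (open and connected) whose complement $\mathbb R^2\setminus D$ is bounded and simply connected, and whose boundary $\Gamma=\partial D$ is of class $C^2$. Let $\rho>0$, $\mu>0$ and $\lambda$ with $\lambda+2\mu>0$ be real constants, put $c_s=\sqrt{\mu/\rho}$, $c_p=\sqrt{(\lambda+2\mu)/\rho}$, and let $$\Delta^*u=c_s^2\,\Delta u+(c_p^2-c_s^2)\,\nabla(\nabla\cdot u)$$ be the Lamé operator acting on vector fields with values in $\mathbb R^2$. Let $\kappa>0$, $\beta_n=\kappa^2(n+1)$, and let $f_n:\Gamma\to\mathbb R^2$, $n=0,1,2,\dots$, be given. Then there is at most one sequence $(u_n)_{n\ge 0}$ of functions $u_n\in C^2(D;\mathbb R^2)\cap C(\overline D;\mathbb R^2)$ such that for every $n\ge 0$ $$\Delta^*u_n-\kappa^2u_n=\sum_{m=0}^{n-1}\beta_{n-m}\,u_m\quad\text{in }D,$$ $$u_n=f_n\quad\text{on }\Gamma,$$ $$u_n(x)\to 0\quad\text{as }|x|\to\infty,\text{ uniformly in all directions } x/|x|.$$ That is, if $(u_n)$ and $(v_n)$ are two such sequences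 (for the same $f_n$), then $u_n=v_n$ on $\overline D$ for all $n\ge0$. -/

import Mathlib

open scoped Topology Laplacian Gradient

noncomputable section

namespace Elastodynamics

/-- The Euclidean plane. -/
abbrev Plane : Type := EuclideanSpace ℝ (Fin 2)

/-- The boundary of the set `D` is of class `C²`: near each boundary point, `D` is the positivity
set of a `C²` function with non-vanishing derivative at that point (so `D` lies locally on one side
of a `C²` curve). -/
def HasC2Boundary (D : Set Plane) : Prop :=
  ∀ x ∈ frontier D, ∃ (U : Set Plane) (ψ : Plane → ℝ), IsOpen U ∧ x ∈ U ∧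
    ContDiffOn ℝ 2 ψ U ∧ fderiv ℝ ψ x ≠ 0 ∧ D ∩ U = {y ∈ U | 0 < ψ y}

/-- An unbounded plane domain with bounded, simply connected complement and `C²` boundary. -/
structure IsExteriorDomain (D : Set Plane) : Prop where
  isOpen : IsOpen D
  isConnected : IsConnected D
  not_isBounded : ¬ Bornology.IsBounded D
  isBounded_compl : Bornology.IsBounded Dᶜ
  isSimplyConnected_compl : IsSimplyConnected Dᶜ
  hasC2Boundary : HasC2Boundary D

/-- The shear velocity `c_s = √(μ/ρ)`. -/
def shearVelocity (mu rho : ℝ) : ℝ := √(mu / rho)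

/-- The pressure velocity `c_p = √((λ + 2μ)/ρ)`. -/
def pressureVelocity (lam mu rho : ℝ) : ℝ := √((lam + 2 * mu) / rho)

/-- The divergence `∂₁u₁ + ∂₂u₂` of a plane vector field. -/
def divergence (u : Plane → Plane) (x : Plane) : ℝ :=
  ∑ i : Fin 2, fderiv ℝ u x (EuclideanSpace.single i 1) i

/-- The Lamé operator `Δ* u = c_s² Δ u + (c_p² - c_s²) ∇ (∇ · u)`. -/
def lameOperator (lam mu rho : ℝ) (u : Plane → Plane) (x : Plane) : Plane :=
  shearVelocity mu rho ^ 2 • Δ u x +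
    (pressureVelocity lam mu rho ^ 2 - shearVelocity mu rho ^ 2) • ∇ (divergence u) x

/-- The coefficients `β_n = κ² (n + 1)`. -/
def beta (kappa : ℝ) (n : ℕ) : ℝ := kappa ^ 2 * ((n : ℝ) + 1)

/-- `u = (u_n)` is a classical solution of the sequence of stationary exterior Dirichlet problems in
`D` with boundary data `f = (f_n)`. Only the values of `u_n` on the closure of `D` and of `f_n` on
the boundary of `D` matter. -/
structure IsSolution (lam mu rho kappa : ℝ) (D : Set Plane) (f u : ℕ → Plane → Plane) : Prop where
  contDiffOn : ∀ n, ContDiffOn ℝ 2 (u n) D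
  continuousOn : ∀ n, ContinuousOn (u n) (closure D)
  equation : ∀ n, ∀ x ∈ D, lameOperator lam mu rho (u n) x - kappa ^ 2 • u n x =
    ∑ m ∈ Finset.range n, beta kappa (n - m) • u m x
  boundary : ∀ n, ∀ x ∈ frontier D, u n x = f n x
  tendsto_zero : ∀ n, Filter.Tendsto (u n)
    (Bornology.cobounded Plane ⊓ Filter.principal D) (𝓝 0)

end Elastodynamics

end

/-! By strong induction on `n` the right-hand sides agree, so the difference `W = u_n - v_n`,
extended by zero outside `D`, is bounded, continuous and solves `Δ* W = κ² W` in `D`. As `W` is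
merely continuous up to `Γ`, its gradient might not be square integrable there, so the equation
cannot be tested with `W` itself, and an elliptic system has no maximum principle to fall back on.
The proof is by duality.

Fix `x₀ ∈ D`, a bump `θ` at `x₀`, and `g = θ W`. Let `v` almost minimize `E(v,v)/2 - ∫ g·v` among
`C¹` fields with compact support in `D`, where `E` is the elastic energy plus `κ² ∫ |v|²`. Let `φ`
cut off the strip of width `s` along `Γ` and a neighbourhood of infinity beyond the support of `v`.
Near-minimality gives `E(v, φ²W) ≈ ∫ g·φ²W = ∫ θ|W|²` (`IsNearMinimizer.sq_le`). The equation for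
`W` reduces the same quantity to terms containing `∇φ` (`IsCutoff.energy_pairing`), of size `s⁻¹ ∫
(|∇v||W| + φ|∇W||v|)` over the strip. If `|W| ≤ ω` there, these are `O(ω)`: `∫ |∇v|² = O(s)` in the
strip, hence `∫ |v|² = O(s³)` by Poincaré, while Caccioppoli gives `∫ φ²|∇W|² = O(ω²/s + 1)`.
Letting `ω → 0` yields `W x₀ = 0`.

The rate `O(s)` replaces boundary regularity. A field `ξ` transversal to `Γ` gives the competitor
`v(x - hξ(x))`, whose energy exceeds that of `v` by `O(h)`. By convexity the difference of the two
has energy `O(h)` up to the minimization error, and in a strip of width proportional to `h` it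
equals `-v` (`IsNearMinimizer.integral_strip_le`).

Under `λ + 2μ > 0` alone the Lamé density need not be coercive as a quadratic form in the gradient.
Adding a multiple of the determinant, which leaves the equation unchanged, makes it so
(`isElliptic_lameForm`). -/

noncomputable section

namespace Elastodynamics

open MeasureTheory Metric Set Filter

/-! ### Outward cones and a transversal vector field -/

section Geometry

variable {E : Type*} [NormedAddCommGroup E] [NormedSpace ℝ E]

/-- Near `y`, the set `K` is stable under small translations in directions close to `-e`. -/
def HasOutwardCone (K : Set E) (y e : E) (r : ℝ) : Prop :=
  ∀ z ∈ K, z ∈ ball y r → ∀ e' : E, ‖e' - e‖ < r → ∀ t ∈ Icc 0 r, z - t • e' ∈ K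

lemma HasOutwardCone.mono {K : Set E} {y e : E} {r r' : ℝ} (h : HasOutwardCone K y e r)
    (hr : r' ≤ r) : HasOutwardCone K y e r' :=
  fun z hz hzy e' he' t ht => h z hz (ball_subset_ball hr hzy) e' (he'.trans_le hr) t
    ⟨ht.1, ht.2.trans hr⟩

/-- The complement of a positivity set of a function with non-vanishing strict derivative has the
outward cone property. -/
lemma exists_hasOutwardCone_of_hasStrictFDerivAt {D U : Set E} {ψ : E → ℝ} {L : E →L[ℝ] ℝ} {y : E}
    (hU : IsOpen U) (hy : y ∈ U) (hψ : HasStrictFDerivAt ψ L y) (hL : L ≠ 0)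
    (hD : D ∩ U = {x ∈ U | 0 < ψ x}) :
    ∃ (e : E) (r : ℝ), 0 < r ∧ HasOutwardCone Dᶜ y e r := by
  obtain ⟨e₀, he₀⟩ : ∃ e₀, L e₀ ≠ 0 := by
    by_contra! h
    exact hL (ContinuousLinearMap.ext h)
  -- Slope 2 leaves room for two losses: directions within `r` of `e` still have slope at least 1,
  -- and the linearization error along `t • e'` is at most `t`. Hence `ψ` does not increase from `z`
  -- to `z - t • e'`.
  obtain ⟨e, he⟩ : ∃ e, L e = 2 := ⟨(2 / L e₀) • e₀, by simp [he₀]⟩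
  set η : ℝ := 1 / (‖e‖ + 1) with hη
  have hη0 : 0 < η := by positivity
  obtain ⟨s, hs, happ⟩ := hψ.approximates_deriv_on_nhds (c := ⟨η, hη0.le⟩) (Or.inr hη0)
  obtain ⟨R, hR, hball⟩ := Metric.mem_nhds_iff.1 (inter_mem hs (hU.mem_nhds hy))
  set r : ℝ := min (min 1 (R / (2 * (‖e‖ + 2)))) (1 / (‖L‖ + 1)) with hr
  have hr0 : 0 < r := by positivity
  have hr1 : r ≤ 1 := (min_le_left _ _).trans (min_le_left _ _)
  have hrR : r * (2 * (‖e‖ + 2)) ≤ R :=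
    (le_div_iff₀ (by positivity)).1 ((min_le_left _ _).trans (min_le_right _ _))
  have hrL : r * (‖L‖ + 1) ≤ 1 := (le_div_iff₀ (by positivity)).1 (min_le_right _ _)
  refine ⟨e, r, hr0, fun z hz hzy e' he' t ht hmem => hz ?_⟩
  have hrR' : 2 * r * ‖e‖ + 4 * r ≤ R := by linarith
  have hre : 0 ≤ r * ‖e‖ := by positivity
  have hzR : z ∈ ball y R := ball_subset_ball (by linarith) hzy
  have hne : ‖e'‖ ≤ ‖e‖ + 1 := by
    calc ‖e'‖ = ‖e + (e' - e)‖ := by congr 1; abel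
      _ ≤ ‖e‖ + ‖e' - e‖ := norm_add_le _ _
      _ ≤ _ := by linarith
  have hzt : z - t • e' ∈ ball y R := by
    rw [mem_ball, dist_eq_norm] at *
    calc ‖z - t • e' - y‖ = ‖(z - y) - t • e'‖ := by congr 1; abel
      _ ≤ ‖z - y‖ + ‖t • e'‖ := norm_sub_le _ _
      _ < r + r * (‖e‖ + 1) := by
        rw [norm_smul, Real.norm_of_nonneg ht.1]
        exact add_lt_add_of_lt_of_le hzy (mul_le_mul ht.2 hne (norm_nonneg _) hr0.le)
      _ ≤ R := by linarith
  have h1 := hball hzR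
  have h2 := hball hzt
  have hψt : 0 < ψ (z - t • e') := by
    have : z - t • e' ∈ D ∩ U := ⟨hmem, h2.2⟩
    rw [hD] at this
    exact this.2
  have key := happ z h1.1 _ h2.1
  have hLe : 1 ≤ L e' := by
    have : L e' = 2 + L (e' - e) := by rw [map_sub, he]; ring
    have h3 : ‖L (e' - e)‖ ≤ ‖L‖ * r := (L.le_opNorm _).trans (by gcongr)
    have := (abs_le.1 (Real.norm_eq_abs _ ▸ h3)).1
    nlinarith
  have hkey : |ψ z - ψ (z - t • e') - t * L e'| ≤ t := by
    have : z - (z - t • e') = t • e' := by abel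
    rw [this, map_smul, smul_eq_mul, Real.norm_eq_abs, norm_smul, Real.norm_of_nonneg ht.1] at key
    refine key.trans ?_
    change η * (t * ‖e'‖) ≤ t
    have : η * ‖e'‖ ≤ 1 := by
      rw [hη, one_div, inv_mul_le_iff₀ (by positivity)]; linarith
    nlinarith [ht.1]
  have hz' : 0 < ψ z := by nlinarith [(abs_le.1 hkey).1, ht.1]
  have : z ∈ D ∩ U := by rw [hD]; exact ⟨h1.2, hz'⟩
  exact this.1

variable [FiniteDimensional ℝ E]

/-- A compact set with the outward cone property admits a smooth vector field, supported near the
set, whose backward flow steps push a proportional neighbourhood of the set into the set. -/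
theorem exists_transversal_field {K : Set E} (hK : IsCompact K) (hne : K.Nonempty)
    (hcone : ∀ y ∈ frontier K, ∃ (e : E) (r : ℝ), 0 < r ∧ HasOutwardCone K y e r)
    {d : ℝ} (hd : 0 < d) :
    ∃ ξ : E → E, ContDiff ℝ 1 ξ ∧ HasCompactSupport ξ ∧ (∀ x, ξ x ≠ 0 → infDist x K < d) ∧
      ∃ c > 0, ∃ h₀ > 0, ∀ h ∈ Ioc 0 h₀, ∀ x, infDist x K ≤ c * h → x - h • ξ x ∈ K := by
  have hcone' : ∀ y : frontier K, ∃ (e : E) (r : ℝ), 0 < r ∧ r < d ∧ HasOutwardCone K y e r := by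
    rintro ⟨y, hy⟩
    obtain ⟨e, r, hr, h⟩ := hcone y hy
    exact ⟨e, min r (d / 2), by positivity, (min_le_right _ _).trans_lt (by linarith),
      h.mono (min_le_left _ _)⟩
  choose e r hr hrd hec using hcone'
  have hFc : IsCompact (frontier K) := hK.of_isClosed_subset isClosed_frontier hK.isClosed.frontier_subset
  obtain ⟨I, hI⟩ := hFc.elim_finite_subcover (fun y : frontier K => ball (y : E) (r y / 4))
    (fun _ => isOpen_ball) (fun y hy => mem_iUnion.2 ⟨⟨y, hy⟩, mem_ball_self (by
      have := hr ⟨y, hy⟩; positivity)⟩)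
  obtain ⟨ρ, hρ, hthick⟩ := hFc.exists_thickening_subset_open
    (isOpen_biUnion fun _ _ => isOpen_ball) hI
  let χ : ∀ y : frontier K, ContDiffBump (y : E) := fun y =>
    ⟨r y / 4, r y / 2, by have := hr y; positivity, by have := hr y; linarith⟩
  -- No partition of unity is needed: the displacements of the separate charts are performed one
  -- after another, and each of them stays in `K` by its own cone property.
  let ξ : E → E := fun x => ∑ y ∈ I, χ y x • e y
  have hsupp : ∀ y x, χ y x ≠ 0 → x ∈ ball (y : E) (r y / 2) := fun y x hx => by
    rw [← (χ y).support_eq]; exact hx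
  refine ⟨ξ, ?_, ?_, ?_, ?_⟩
  · exact ContDiff.sum fun y _ => (χ y).contDiff.smul contDiff_const
  · refine HasCompactSupport.of_support_subset_isCompact
      (I.isCompact_biUnion fun y _ => isCompact_closedBall (y : E) (r y)) fun x hx => ?_
    obtain ⟨y, hy, hyx⟩ := Finset.exists_ne_zero_of_sum_ne_zero hx
    refine mem_biUnion hy (ball_subset_closedBall (ball_subset_ball ?_ (hsupp y x ?_)))
    · linarith [hr y]
    · exact fun h => hyx (by rw [h, zero_smul])
  · intro x hx
    obtain ⟨y, hy, hyx⟩ := Finset.exists_ne_zero_of_sum_ne_zero hx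
    have := hsupp y x fun h => hyx (by rw [h, zero_smul])
    refine (infDist_le_dist_of_mem (hK.isClosed.frontier_subset y.2)).trans_lt ?_
    rw [mem_ball] at this
    linarith [hr y, hrd y]
  · obtain ⟨c, hc0, hc⟩ : ∃ c > 0, ∀ y ∈ I, c < r y := by
      have : ∀ᶠ c : ℝ in 𝓝[>] 0, ∀ y ∈ I, c < r y :=
        (Filter.eventually_all_finset I).2 fun y _ => nhdsWithin_le_nhds (gt_mem_nhds (hr y))
      obtain ⟨c, hc, hc'⟩ := (this.and self_mem_nhdsWithin).exists
      exact ⟨c, hc', hc⟩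
    set N : ℝ := ∑ y ∈ I, ‖e y‖ with hN
    have hN0 : 0 ≤ N := Finset.sum_nonneg fun _ _ => norm_nonneg _
    have hcN : 0 < 2 * (c + N) := by positivity
    refine ⟨c, hc0, min c (min (c / (2 * (c + N))) (ρ / (2 * c))), by positivity, ?_⟩
    rintro h ⟨hh0, hh⟩ x hx
    have hhc' : h ≤ c := hh.trans (min_le_left _ _)
    have hhc : h * (2 * (c + N)) ≤ c :=
      (le_div_iff₀ hcN).1 (hh.trans ((min_le_right _ _).trans (min_le_left _ _)))
    have hhρ : h * (2 * c) ≤ ρ :=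
      (le_div_iff₀ (by positivity)).1 (hh.trans ((min_le_right _ _).trans (min_le_right _ _)))
    have hch : 0 < c * h := by positivity
    have hNh : 0 ≤ N * h := by positivity
    -- partial sums of the displacement keep the point in `K`
    have key : ∀ (J : Finset (frontier K)), J ⊆ I → ∀ z' ∈ K, ∀ b, ‖z' - x‖ ≤ b →
        b + h * ∑ y ∈ J, ‖e y‖ ≤ c / 2 → z' - h • ∑ y ∈ J, χ y x • e y ∈ K := by
      classical
      intro J
      induction J using Finset.induction_on with
      | empty => intro _ z' hz' _ _ _; simpa using hz'
      | insert j J hj ih =>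
        intro hJ z' hz' b hb hsum
        rw [Finset.sum_insert hj] at hsum ⊢
        have hej : 0 ≤ h * ‖e j‖ := by positivity
        have h1 := ih (fun y hy => hJ (Finset.mem_insert_of_mem hy)) z' hz' b hb (by linarith)
        have hjI : j ∈ I := hJ (Finset.mem_insert_self _ _)
        have heq : z' - h • (χ j x • e j + ∑ y ∈ J, χ y x • e y) =
            (z' - h • ∑ y ∈ J, χ y x • e y) - (h * χ j x) • e j := by
          rw [smul_add, smul_smul]; abel
        rw [heq]
        by_cases hχ : χ j x = 0
        · simpa [hχ] using h1
        have hxj := hsupp j x hχ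
        refine hec j _ h1 ?_ _ (by simpa using hr j) _
          ⟨mul_nonneg hh0.le (χ j).nonneg, ?_⟩
        · have h2 : ‖h • ∑ y ∈ J, χ y x • e y‖ ≤ h * ∑ y ∈ J, ‖e y‖ := by
            rw [norm_smul, Real.norm_of_nonneg hh0.le]
            gcongr
            refine norm_sum_le_of_le _ fun y _ => ?_
            rw [norm_smul, Real.norm_of_nonneg (χ y).nonneg]
            exact mul_le_of_le_one_left (norm_nonneg _) (χ y).le_one
          rw [mem_ball, dist_eq_norm] at hxj ⊢
          calc ‖z' - h • ∑ y ∈ J, χ y x • e y - (j : E)‖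
              = ‖(z' - x) - h • ∑ y ∈ J, χ y x • e y + (x - j)‖ := by congr 1; abel
            _ ≤ ‖z' - x‖ + ‖h • ∑ y ∈ J, χ y x • e y‖ + ‖x - (j : E)‖ :=
              (norm_add_le _ _).trans (add_le_add_left (norm_sub_le _ _) _)
            _ < r j := by linarith [hc j hjI]
        · calc h * χ j x ≤ h * 1 := by gcongr; exact (χ j).le_one
            _ ≤ r j := by linarith [hc j hjI]
    obtain ⟨z, hzK, hz⟩ := hK.exists_infDist_eq_dist hne x
    rw [hz, dist_eq_norm] at hx
    by_cases hxU : ∃ y ∈ I, x ∈ ball (y : E) (r y / 4)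
    · classical
      obtain ⟨y, hyI, hy⟩ := hxU
      have hχ : χ y x = 1 := (χ y).one_of_mem_closedBall (ball_subset_closedBall hy)
      have hcy := hc y hyI
      -- The point `z` of `K` nearest to `x`, moved along the tilted direction `e y + h⁻¹ • (z -
      -- x)`, lands exactly at `x - h • e y`. The tilt is at most `c < r y` because `infDist x K ≤ c
      -- * h`.
      have h1 : x - h • e y ∈ K := by
        have := hec y z hzK ?_ (e y + h⁻¹ • (z - x)) ?_ h ⟨hh0.le, by linarith⟩
        · rw [smul_add, smul_smul, mul_inv_cancel₀ hh0.ne', one_smul] at this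
          convert this using 1; abel
        · rw [mem_ball, dist_eq_norm] at hy ⊢
          calc ‖z - (y : E)‖ = ‖(x - (y : E)) - (x - z)‖ := by congr 1; abel
            _ ≤ ‖x - (y : E)‖ + ‖x - z‖ := norm_sub_le _ _
            _ < r y := by linarith
        · rw [add_sub_cancel_left, norm_smul, norm_inv, Real.norm_of_nonneg hh0.le,
            inv_mul_lt_iff₀ hh0, norm_sub_rev]
          nlinarith
      have hsum : ∑ y ∈ I, ‖e y‖ = ‖e y‖ + ∑ y ∈ I.erase y, ‖e y‖ :=
        (Finset.add_sum_erase I (fun y => ‖e y‖) hyI).symm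
      have h2 := key (I.erase y) (Finset.erase_subset _ _) _ h1 (h * ‖e y‖) (by
        rw [sub_sub_cancel_left, norm_neg, norm_smul, Real.norm_of_nonneg hh0.le])
        (by rw [← mul_add, ← hsum, ← hN]; linarith)
      have h3 : ξ x = e y + ∑ y ∈ I.erase y, χ y x • e y := by
        change ∑ y ∈ I, χ y x • e y = _
        rw [← Finset.add_sum_erase I _ hyI, hχ, one_smul]
      rw [h3, smul_add]
      convert h2 using 1
      abel
    -- A point outside `K` at distance at most `c * h < ρ` would lie in the `ρ`-thickening of the
    -- frontier, which the quarter balls cover.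
    · have hxK : x ∈ K := by
        by_contra hxK
        obtain ⟨p, hp, hpd⟩ := exists_mem_frontier_infDist_compl_eq_dist (s := Kᶜ) (x := x) hxK
          (by simpa using hne.ne_empty)
        rw [compl_compl, frontier_compl] at *
        refine hxU ?_
        have : x ∈ thickening ρ (frontier K) := mem_thickening_iff.2 ⟨p, hp, by
          rw [← hpd, hz, dist_eq_norm]; linarith⟩
        simpa using hthick this
      exact key I subset_rfl x hxK 0 (by simp) (by rw [← hN]; linarith)

end Geometry

/-! ### Change of variables under small shifts, and the volume of a strip -/

section Shift

lemma abs_apply_single_le (A : Plane →L[ℝ] Plane) (i j : Fin 2) :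
    |A (EuclideanSpace.single j 1) i| ≤ ‖A‖ := by
  have h1 : ‖A (EuclideanSpace.single j 1) i‖ ≤ ‖A (EuclideanSpace.single j 1)‖ :=
    PiLp.norm_apply_le _ _
  have h2 := A.le_opNorm (EuclideanSpace.single j (1 : ℝ))
  simp only [PiLp.norm_single, norm_one, mul_one] at h2
  exact h1.trans h2

lemma det_eq_apply_single (A : Plane →L[ℝ] Plane) :
    A.det = A (EuclideanSpace.single 0 1) 0 * A (EuclideanSpace.single 1 1) 1 -
      A (EuclideanSpace.single 1 1) 0 * A (EuclideanSpace.single 0 1) 1 := by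
  rw [ContinuousLinearMap.det, ← LinearMap.det_toMatrix (EuclideanSpace.basisFun (Fin 2) ℝ).toBasis,
    Matrix.det_fin_two]
  simp [LinearMap.toMatrix_apply]

/-- In the expanded 2×2 determinant the diagonal terms cost at most `2hL`, and each of the two
products at most `(hL)² ≤ hL`. -/
lemma one_sub_le_det_one_sub_smul (A : Plane →L[ℝ] Plane) {L h : ℝ} (hA : ‖A‖ ≤ L) (hh : 0 ≤ h)
    (hL : h * L ≤ 1) : 1 - 4 * (h * L) ≤ (ContinuousLinearMap.id ℝ Plane - h • A).det := by
  rw [det_eq_apply_single]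
  have H : ∀ i j, |h * A (EuclideanSpace.single j 1) i| ≤ h * L := fun i j => by
    rw [abs_mul, abs_of_nonneg hh]
    gcongr
    exact (abs_apply_single_le A i j).trans hA
  have h00 := abs_le.1 (H 0 0)
  have h11 := abs_le.1 (H 1 1)
  have h01 := abs_le.1 (H 0 1)
  have h10 := abs_le.1 (H 1 0)
  simp
  set p := h * A (EuclideanSpace.single 0 1) 0
  set q := h * A (EuclideanSpace.single 1 1) 1
  set r := h * A (EuclideanSpace.single 1 1) 0
  set s := h * A (EuclideanSpace.single 0 1) 1
  set b := h * L
  have h1 : r * s ≤ b := by nlinarith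
  have h2 : -b ≤ p * q := by nlinarith
  nlinarith

variable {ξ : Plane → Plane}

lemma hasFDerivAt_shift (hξ : ContDiff ℝ 1 ξ) (h : ℝ) (x : Plane) :
    HasFDerivAt (fun x => x - h • ξ x) (ContinuousLinearMap.id ℝ Plane - h • fderiv ℝ ξ x) x :=
  (hasFDerivAt_id x).sub (((hξ.differentiable (by norm_num)) x).hasFDerivAt.const_smul h)

lemma injective_shift {L : NNReal} (hL : LipschitzWith L ξ) {h : ℝ} (hh : 0 ≤ h)
    (hhL : h * L < 1) : Function.Injective fun x => x - h • ξ x := by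
  intro x y hxy
  by_contra hne
  have h1 : x - y = h • (ξ x - ξ y) := by
    have : x - h • ξ x = y - h • ξ y := hxy
    rw [smul_sub, sub_eq_sub_iff_add_eq_add]
    rw [sub_eq_sub_iff_add_eq_add] at this
    rw [this, add_comm]
  have h2 := hL.dist_le_mul x y
  rw [dist_eq_norm, dist_eq_norm] at h2
  have h3 : ‖x - y‖ ≤ h * (L * ‖x - y‖) := by
    conv_lhs => rw [h1, norm_smul, Real.norm_of_nonneg hh]
    gcongr
  have : 0 < ‖x - y‖ := norm_pos_iff.2 (sub_ne_zero.2 hne)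
  nlinarith

/-- Composition with a small shift along `ξ` increases integrals by a factor `1 + O(h)` at most. -/
lemma lintegral_comp_shift_le (hξ : ContDiff ℝ 1 ξ) {L : NNReal} (hL : LipschitzWith L ξ) {h : ℝ}
    (hh : 0 ≤ h) (hhL : 8 * (h * L) ≤ 1) (G : Plane → ENNReal) :
    ∫⁻ x, G (x - h • ξ x) ≤ ENNReal.ofReal (1 + 8 * L * h) * ∫⁻ x, G x := by
  have hhL0 : 0 ≤ h * L := by positivity
  have hdet : ∀ x, 1 ≤ (1 + 8 * L * h) *
      |(ContinuousLinearMap.id ℝ Plane - h • fderiv ℝ ξ x).det| := fun x => by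
    have h1 := one_sub_le_det_one_sub_smul (fderiv ℝ ξ x) (norm_fderiv_le_of_lipschitz ℝ hL) hh
      (by linarith)
    have h2 := h1.trans (le_abs_self _)
    -- The product is `1 + 4hL - 32(hL)²`, so the inequality is exactly the smallness condition `8hL
    -- ≤ 1`.
    calc (1 : ℝ) ≤ (1 + 8 * L * h) * (1 - 4 * (h * L)) := by nlinarith
      _ ≤ _ := by gcongr
  have key := lintegral_image_eq_lintegral_abs_det_fderiv_mul volume MeasurableSet.univ
    (fun x _ => (hasFDerivAt_shift hξ h x).hasFDerivWithinAt)
    (injective_shift hL hh (by linarith)).injOn G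
  calc ∫⁻ x, G (x - h • ξ x)
      ≤ ∫⁻ x, ENNReal.ofReal (1 + 8 * L * h) *
        (ENNReal.ofReal |(ContinuousLinearMap.id ℝ Plane - h • fderiv ℝ ξ x).det| *
          G (x - h • ξ x)) := by
        refine lintegral_mono fun x => ?_
        rw [← mul_assoc, ← ENNReal.ofReal_mul (by positivity)]
        refine le_mul_of_one_le_left zero_le ?_
        rw [← ENNReal.ofReal_one]
        exact ENNReal.ofReal_le_ofReal (hdet x)
    _ = ENNReal.ofReal (1 + 8 * L * h) * ∫⁻ x in (fun x => x - h • ξ x) '' univ, G x := by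
        rw [lintegral_const_mul' _ _ ENNReal.ofReal_ne_top, key, setLIntegral_univ]
    _ ≤ _ := by gcongr; exact Measure.restrict_le_self

lemma integral_comp_shift_le (hξ : ContDiff ℝ 1 ξ) {L : NNReal} (hL : LipschitzWith L ξ) {h : ℝ}
    (hh : 0 ≤ h) (hhL : 8 * (h * L) ≤ 1) {G : Plane → ℝ} (hG : Continuous G) (hG0 : ∀ x, 0 ≤ G x)
    (hGi : Integrable G) :
    ∫ x, G (x - h • ξ x) ≤ (1 + 8 * L * h) * ∫ x, G x := by
  have hc : Continuous fun x => G (x - h • ξ x) := by have := hξ.continuous; fun_prop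
  rw [integral_eq_lintegral_of_nonneg_ae (ae_of_all _ fun _ => hG0 _) hc.aestronglyMeasurable,
    integral_eq_lintegral_of_nonneg_ae (ae_of_all _ hG0) hG.aestronglyMeasurable,
    ← ENNReal.toReal_ofReal (r := 1 + 8 * L * h) (by positivity), ← ENNReal.toReal_mul]
  refine ENNReal.toReal_mono ?_ (lintegral_comp_shift_le hξ hL hh hhL fun x => ENNReal.ofReal (G x))
  refine ENNReal.mul_ne_top ENNReal.ofReal_ne_top ?_
  have := hGi.hasFiniteIntegral
  rw [hasFiniteIntegral_iff_ofReal (ae_of_all _ hG0)] at this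
  exact this.ne

/-- The points of `D` at distance at most `s` from the complement of `D`. -/
def strip (D : Set Plane) (s : ℝ) : Set Plane := {x ∈ D | infDist x Dᶜ ≤ s}

lemma strip_mono {D : Set Plane} {s t : ℝ} (h : s ≤ t) : strip D s ⊆ strip D t :=
  fun _ hx => ⟨hx.1, hx.2.trans h⟩

lemma measurableSet_strip {D : Set Plane} (hD : IsOpen D) (s : ℝ) : MeasurableSet (strip D s) :=
  hD.measurableSet.inter
    (isClosed_le (continuous_infDist_pt _) continuous_const).measurableSet

/-- The shift sends both the strip and `Dᶜ` into `Dᶜ`, while changing volumes by a factor `1 + O(h)`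
at most. Cancelling the finite volume of `Dᶜ` leaves `O(h)` for the strip. -/
lemma volume_strip_le {D : Set Plane} (hD : IsOpen D) (hK : Bornology.IsBounded Dᶜ)
    (hξ : ContDiff ℝ 1 ξ) {L : NNReal} (hL : LipschitzWith L ξ) {h s : ℝ}
    (hh : 0 ≤ h) (hs : 0 ≤ s) (hhL : 8 * (h * L) ≤ 1)
    (hpush : ∀ x, infDist x Dᶜ ≤ s → x - h • ξ x ∈ Dᶜ) :
    volume (strip D s) ≤ ENNReal.ofReal (8 * L * h) * volume Dᶜ := by
  have hKfin : volume Dᶜ ≠ ⊤ := hK.measure_lt_top.ne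
  have hm : MeasurableSet Dᶜ := hD.measurableSet.compl
  have key := lintegral_comp_shift_le hξ hL hh hhL (Dᶜ.indicator 1)
  rw [lintegral_indicator_one hm, add_comm, ENNReal.ofReal_add (by positivity) zero_le_one,
    ENNReal.ofReal_one, add_mul, one_mul] at key
  have h2 : volume (strip D s) + volume Dᶜ ≤ ∫⁻ x, Dᶜ.indicator 1 (x - h • ξ x) := by
    have hdisj : Disjoint (strip D s) Dᶜ := disjoint_compl_right.mono_left fun x hx => hx.1
    rw [← measure_union hdisj hm, ← lintegral_indicator_one ((measurableSet_strip hD s).union hm)]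
    refine lintegral_mono fun x => ?_
    by_cases hx : x ∈ strip D s ∪ Dᶜ
    · have : x - h • ξ x ∈ Dᶜ := hpush x (by
        rcases hx with hx | hx
        · exact hx.2
        · rw [infDist_zero_of_mem hx]; exact hs)
      rw [indicator_of_mem hx, indicator_of_mem this, Pi.one_apply, Pi.one_apply]
    · rw [indicator_of_notMem hx]; exact zero_le
  exact (ENNReal.add_le_add_iff_right hKfin).1 (h2.trans key)

end Shift

/-! ### Poincaré inequality in a thin strip -/

section Poincare

/-- The variance of `q` on the unit interval is nonnegative. -/
lemma sq_integral_le_integral_sq {q : ℝ → ℝ} (hq : Continuous q) :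
    (∫ t in (0 : ℝ)..1, q t) ^ 2 ≤ ∫ t in (0 : ℝ)..1, q t ^ 2 := by
  set A := ∫ t in (0 : ℝ)..1, q t
  have h1 : 0 ≤ ∫ t in (0 : ℝ)..1, (q t - A) ^ 2 :=
    intervalIntegral.integral_nonneg zero_le_one fun _ _ => sq_nonneg _
  have h2 : ∫ t in (0 : ℝ)..1, (q t - A) ^ 2 = (∫ t in (0 : ℝ)..1, q t ^ 2) - 2 * A * A + A ^ 2 := by
    have : ∀ t, (q t - A) ^ 2 = q t ^ 2 - 2 * A * q t + A ^ 2 := fun t => by ring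
    simp_rw [this]
    rw [intervalIntegral.integral_add, intervalIntegral.integral_sub,
      intervalIntegral.integral_const_mul]
    · simp [A]
    all_goals exact Continuous.intervalIntegrable (by fun_prop) _ _
  nlinarith

lemma fderiv_eq_zero_of_notMem_tsupport {v : Plane → Plane} {x : Plane} (hx : x ∉ tsupport v) :
    fderiv ℝ v x = 0 := by
  rw [(notMem_tsupport_iff_eventuallyEq.1 hx).fderiv_eq]
  simp

/-- If `v` vanishes at the endpoint of a segment, then its value at the starting point is controlled
by the gradient along the segment. -/
lemma norm_sq_le_integral_of_eq_zero {v : Plane → Plane} (hv : ContDiff ℝ 1 v) {x w : Plane} {M : ℝ}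
    (hw : ‖w‖ ≤ M) (h0 : v (x - w) = 0) :
    ‖v x‖ ^ 2 ≤ ∫ t in (0 : ℝ)..1, M ^ 2 * ‖fderiv ℝ v (x - t • w)‖ ^ 2 := by
  have hM : 0 ≤ M := (norm_nonneg _).trans hw
  have hc : Continuous fun t : ℝ => fderiv ℝ v (x - t • w) :=
    (hv.continuous_fderiv (by norm_num)).comp (by fun_prop)
  have hd : ∀ t : ℝ, HasDerivAt (fun t : ℝ => v (x - t • w)) (fderiv ℝ v (x - t • w) (-w)) t := by
    intro t
    have h1 : HasDerivAt (fun t : ℝ => x - t • w) (-w) t := by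
      simpa using ((hasDerivAt_id t).smul_const w).const_sub x
    exact ((hv.differentiable (by norm_num)) _).hasFDerivAt.comp_hasDerivAt t h1
  have hftc := intervalIntegral.integral_eq_sub_of_hasDerivAt (a := 0) (b := 1)
    (fun t _ => hd t) (Continuous.intervalIntegrable (by fun_prop) _ _)
  simp only [one_smul, h0, zero_smul, sub_zero, zero_sub] at hftc
  have h1 : ‖v x‖ ≤ ∫ t in (0 : ℝ)..1, M * ‖fderiv ℝ v (x - t • w)‖ := by
    rw [← norm_neg, ← hftc]
    refine (intervalIntegral.norm_integral_le_integral_norm zero_le_one).trans ?_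
    refine intervalIntegral.integral_mono_on zero_le_one
      (Continuous.intervalIntegrable (by fun_prop) _ _)
      (Continuous.intervalIntegrable (by fun_prop) _ _) fun t _ => ?_
    refine (ContinuousLinearMap.le_opNorm _ _).trans ?_
    rw [norm_neg, mul_comm]
    gcongr
  calc ‖v x‖ ^ 2 ≤ (∫ t in (0 : ℝ)..1, M * ‖fderiv ℝ v (x - t • w)‖) ^ 2 := by gcongr
    _ ≤ ∫ t in (0 : ℝ)..1, (M * ‖fderiv ℝ v (x - t • w)‖) ^ 2 :=
      sq_integral_le_integral_sq (by fun_prop)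
    _ = _ := by simp_rw [mul_pow]

variable {ξ : Plane → Plane}

lemma infDist_shift_le {K : Set Plane} {M : ℝ} (hM : ∀ x, ‖ξ x‖ ≤ M) {h t s : ℝ} (hh : 0 ≤ h)
    (ht : t ∈ Icc (0 : ℝ) 1) {x : Plane} (hx : infDist x K ≤ s) :
    infDist (x - t • (h • ξ x)) K ≤ s + h * M := by
  have h1 := infDist_le_infDist_add_dist (s := K) (x := x - t • (h • ξ x)) (y := x)
  have h2 : dist (x - t • (h • ξ x)) x ≤ h * M := by
    rw [dist_eq_norm, sub_sub_cancel_left, norm_neg, norm_smul, norm_smul,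
      Real.norm_of_nonneg ht.1, Real.norm_of_nonneg hh]
    have := hM x
    calc t * (h * ‖ξ x‖) ≤ 1 * (h * ‖ξ x‖) := by gcongr; exact ht.2
      _ ≤ h * M := by rw [one_mul]; gcongr
  linarith

/-- Poincaré inequality in a thin strip along the boundary. -/
lemma lintegral_strip_le {D : Set Plane} (hD : IsOpen D)
    (hξ : ContDiff ℝ 1 ξ) {L : NNReal} (hL : LipschitzWith L ξ) {M : ℝ} (hM : ∀ x, ‖ξ x‖ ≤ M)
    {h s : ℝ} (hh : 0 ≤ h) (hhL : 8 * (h * L) ≤ 1)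
    (hpush : ∀ x, infDist x Dᶜ ≤ s → x - h • ξ x ∈ Dᶜ)
    {v : Plane → Plane} (hv : ContDiff ℝ 1 v) (hvD : tsupport v ⊆ D) :
    ∫⁻ x in strip D s, ENNReal.ofReal (‖v x‖ ^ 2) ≤
      ENNReal.ofReal (2 * (h * M) ^ 2) *
        ∫⁻ x in strip D (s + h * M), ENNReal.ofReal (‖fderiv ℝ v x‖ ^ 2) := by
  have hcD : Continuous (fderiv ℝ v) := hv.continuous_fderiv (by norm_num)
  have hcξ := hξ.continuous
  set G : Plane → ENNReal :=
    (strip D (s + h * M)).indicator fun x => ENNReal.ofReal (‖fderiv ℝ v x‖ ^ 2) with hG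
  have hGm : Measurable G :=
    (by fun_prop : Measurable fun x => ENNReal.ofReal (‖fderiv ℝ v x‖ ^ 2)).indicator
      (measurableSet_strip hD _)
  have hpt : ∀ x ∈ strip D s, ENNReal.ofReal (‖v x‖ ^ 2) ≤
      ∫⁻ t in Ioc (0 : ℝ) 1, ENNReal.ofReal ((h * M) ^ 2) * G (x - (t * h) • ξ x) := by
    intro x hx
    have h0 : v (x - h • ξ x) = 0 :=
      image_eq_zero_of_notMem_tsupport fun hmem => hpush x hx.2 (hvD hmem)
    have hw : ‖h • ξ x‖ ≤ h * M := by
      rw [norm_smul, Real.norm_of_nonneg hh]; gcongr; exact hM x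
    have h1 := norm_sq_le_integral_of_eq_zero hv hw h0
    rw [intervalIntegral.integral_of_le zero_le_one] at h1
    refine (ENNReal.ofReal_le_ofReal h1).trans ?_
    rw [ofReal_integral_eq_lintegral_ofReal]
    · refine setLIntegral_mono' measurableSet_Ioc fun t ht => ?_
      rw [ENNReal.ofReal_mul (by positivity), ← smul_smul]
      gcongr
      by_cases hy : x - t • (h • ξ x) ∈ D
      · rw [hG, indicator_of_mem (show _ ∈ strip D (s + h * M) from
          ⟨hy, infDist_shift_le hM hh ⟨ht.1.le, ht.2⟩ hx.2⟩)]
      · rw [fderiv_eq_zero_of_notMem_tsupport fun hmem => hy (hvD hmem)]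
        simp
    · refine (Continuous.integrableOn_Icc ?_).mono_set Ioc_subset_Icc_self
      fun_prop
    · exact ae_of_all _ fun t => by positivity
  calc ∫⁻ x in strip D s, ENNReal.ofReal (‖v x‖ ^ 2)
      ≤ ∫⁻ x in strip D s, ∫⁻ t in Ioc (0 : ℝ) 1,
          ENNReal.ofReal ((h * M) ^ 2) * G (x - (t * h) • ξ x) :=
        setLIntegral_mono' (measurableSet_strip hD _) hpt
    _ ≤ ∫⁻ x, ∫⁻ t in Ioc (0 : ℝ) 1, ENNReal.ofReal ((h * M) ^ 2) * G (x - (t * h) • ξ x) :=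
        setLIntegral_le_lintegral _ _
    -- After Tonelli, for each fixed `t` the inner integral is composed with the shift of size `t *
    -- h ≤ h`, whose Jacobian costs a factor of at most 2.
    _ = ∫⁻ t in Ioc (0 : ℝ) 1, ∫⁻ x, ENNReal.ofReal ((h * M) ^ 2) * G (x - (t * h) • ξ x) := by
        refine lintegral_lintegral_swap (Measurable.aemeasurable ?_)
        refine measurable_const.mul (hGm.comp ?_)
        exact Continuous.measurable (by fun_prop)
    _ ≤ ∫⁻ t in Ioc (0 : ℝ) 1, ENNReal.ofReal ((h * M) ^ 2) * (ENNReal.ofReal 2 * ∫⁻ x, G x) := by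
        refine setLIntegral_mono' measurableSet_Ioc fun t ht => ?_
        rw [lintegral_const_mul' _ _ ENNReal.ofReal_ne_top]
        have hth : t * h ≤ h := mul_le_of_le_one_left hh ht.2
        have hLh : t * h * L ≤ h * L := by gcongr
        gcongr
        refine (lintegral_comp_shift_le hξ hL (mul_nonneg ht.1.le hh) (by linarith) G).trans ?_
        gcongr
        linarith
    _ = _ := by
        rw [setLIntegral_const, Real.volume_Ioc, sub_zero, ENNReal.ofReal_one, mul_one, ← mul_assoc,
          ← ENNReal.ofReal_mul (by positivity), hG, lintegral_indicator (measurableSet_strip hD _),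
          mul_comm (2 : ℝ)]

lemma integral_strip_le {D : Set Plane} (hD : IsOpen D)
    (hξ : ContDiff ℝ 1 ξ) {L : NNReal} (hL : LipschitzWith L ξ) {M : ℝ} (hM : ∀ x, ‖ξ x‖ ≤ M)
    {h s : ℝ} (hh : 0 ≤ h) (hhL : 8 * (h * L) ≤ 1)
    (hpush : ∀ x, infDist x Dᶜ ≤ s → x - h • ξ x ∈ Dᶜ)
    {v : Plane → Plane} (hv : ContDiff ℝ 1 v) (hvc : HasCompactSupport v) (hvD : tsupport v ⊆ D) :
    ∫ x in strip D s, ‖v x‖ ^ 2 ≤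
      2 * (h * M) ^ 2 * ∫ x in strip D (s + h * M), ‖fderiv ℝ v x‖ ^ 2 := by
  have hcD : Continuous (fderiv ℝ v) := hv.continuous_fderiv (by norm_num)
  have hcv := hv.continuous
  have hint : Integrable fun x => ‖fderiv ℝ v x‖ ^ 2 :=
    Continuous.integrable_of_hasCompactSupport (by fun_prop)
      ((hvc.fderiv ℝ).norm.comp_left (g := fun r : ℝ => r ^ 2) (by simp))
  rw [integral_eq_lintegral_of_nonneg_ae (ae_of_all _ fun _ => by positivity)
      (Continuous.aestronglyMeasurable (by fun_prop)),
    integral_eq_lintegral_of_nonneg_ae (ae_of_all _ fun _ => by positivity)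
      (Continuous.aestronglyMeasurable (by fun_prop)),
    ← ENNReal.toReal_ofReal (r := 2 * (h * M) ^ 2) (by positivity), ← ENNReal.toReal_mul]
  refine ENNReal.toReal_mono ?_ (lintegral_strip_le hD hξ hL hM hh hhL hpush hv hvD)
  refine ENNReal.mul_ne_top ENNReal.ofReal_ne_top ?_
  have := hint.integrableOn (s := strip D (s + h * M)) |>.hasFiniteIntegral
  rw [hasFiniteIntegral_iff_ofReal (ae_of_all _ fun _ => by positivity)] at this
  exact this.ne

end Poincare

/-! ### Cutoff functions near the boundary and near infinity -/

section Cutoff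

variable {E : Type*} [NormedAddCommGroup E] [InnerProductSpace ℝ E] [FiniteDimensional ℝ E]
  [MeasurableSpace E] [BorelSpace E]

/-- Mollification: a Lipschitz function is approximated by smooth functions with the same Lipschitz
constant, respecting local bounds. -/
lemma exists_contDiff_lipschitzWith {C : NNReal} {f : E → ℝ} (hf : LipschitzWith C f) {τ : ℝ}
    (hτ : 0 < τ) : ∃ F : E → ℝ, ContDiff ℝ 1 F ∧ LipschitzWith C F ∧
      (∀ x b, (∀ y ∈ ball x τ, f y ≤ b) → F x ≤ b) ∧
      (∀ x b, (∀ y ∈ ball x τ, b ≤ f y) → b ≤ F x) := by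
  let χ : ContDiffBump (0 : E) := ⟨τ / 2, τ, by positivity, by linarith⟩
  set g : E → ℝ := χ.normed volume with hg
  have hgc : Continuous g := χ.continuous_normed
  have hgs : HasCompactSupport g := χ.hasCompactSupport_normed
  have hg0 : ∀ t, 0 ≤ g t := χ.nonneg_normed
  have hg1 : ∫ t, g t = 1 := χ.integral_normed
  have hgi : Integrable g := hgc.integrable_of_hasCompactSupport hgs
  have hfc := hf.continuous
  have hint : ∀ x, Integrable fun t => g t * f (x - t) := fun x =>
    Continuous.integrable_of_hasCompactSupport (by fun_prop) hgs.mul_right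
  refine ⟨convolution g f (ContinuousLinearMap.lsmul ℝ ℝ) volume, ?_, ?_, ?_, ?_⟩
  · exact hgs.contDiff_convolution_left (n := 1) _ χ.contDiff_normed hfc.locallyIntegrable
  · refine LipschitzWith.of_dist_le_mul fun x y => ?_
    simp only [convolution_def, ContinuousLinearMap.lsmul_apply, smul_eq_mul]
    rw [dist_eq_norm, ← integral_sub (hint x) (hint y)]
    refine (norm_integral_le_of_norm_le (hgi.mul_const (C * dist x y)) (ae_of_all _ fun t => ?_)).trans
      (by rw [integral_mul_const, hg1, one_mul])
    rw [← mul_sub, norm_mul, Real.norm_of_nonneg (hg0 t), ← dist_eq_norm]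
    have := hf.dist_le_mul (x - t) (y - t)
    rw [dist_sub_right] at this
    exact mul_le_mul_of_nonneg_left this (hg0 t)
  all_goals
    intro x b hb
    simp only [convolution_def, ContinuousLinearMap.lsmul_apply, smul_eq_mul]
    have hpt : ∀ t, g t ≠ 0 → x - t ∈ ball x τ := fun t ht => by
      have : t ∈ Function.support g := ht
      rw [hg, χ.support_normed_eq] at this
      simpa [dist_eq_norm] using this
  · calc ∫ t, g t * f (x - t) ≤ ∫ t, g t * b := by
          refine integral_mono (hint x) (hgi.mul_const b) fun t => ?_
          by_cases ht : g t = 0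
          · simp [ht]
          · exact mul_le_mul_of_nonneg_left (hb _ (hpt t ht)) (hg0 t)
      _ = b := by rw [integral_mul_const, hg1, one_mul]
  · calc b = ∫ t, g t * b := by rw [integral_mul_const, hg1, one_mul]
      _ ≤ ∫ t, g t * f (x - t) := by
          refine integral_mono (hgi.mul_const b) (hint x) fun t => ?_
          by_cases ht : g t = 0
          · simp [ht]
          · exact mul_le_mul_of_nonneg_left (hb _ (hpt t ht)) (hg0 t)

/-- A function of class `C¹` that vanishes near `K` and equals one away from `K`. -/
lemma exists_cutoff_infDist (K : Set E) {s : ℝ} (hs : 0 < s) :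
    ∃ η : E → ℝ, ContDiff ℝ 1 η ∧ (∀ x, 0 ≤ η x) ∧ (∀ x, η x ≤ 1) ∧
      (∀ x, infDist x K ≤ s / 8 → η x = 0) ∧ (∀ x, s * (7 / 8) ≤ infDist x K → η x = 1) ∧
      ∀ x, ‖fderiv ℝ η x‖ ≤ 4 / s := by
  -- The ramp rises from 0 at distance `s/4` to 1 at distance `3s/4`. Mollifying at scale `s/8`
  -- leaves the margins `s/8` and `7s/8` and preserves the slope `2/s`.
  let f : E → ℝ := fun x => max 0 (min 1 ((2 / s) * infDist x K - 1 / 2))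
  have hf : LipschitzWith (Real.toNNReal (2 / s)) f := by
    refine LipschitzWith.const_max (LipschitzWith.const_min ?_ 1) 0
    refine LipschitzWith.of_dist_le_mul fun x y => ?_
    have := (lipschitz_infDist_pt K).dist_le_mul x y
    rw [Real.coe_toNNReal _ (by positivity), Real.dist_eq] at *
    rw [NNReal.coe_one, one_mul] at this
    rw [sub_sub_sub_cancel_right, ← mul_sub, abs_mul, abs_of_nonneg (by positivity : 0 ≤ 2 / s)]
    gcongr
  obtain ⟨η, h1, h2, h3, h4⟩ := exists_contDiff_lipschitzWith hf (show 0 < s / 8 by positivity)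
  have hη0 : ∀ x, 0 ≤ η x := fun x => h4 x 0 fun y _ => le_max_left _ _
  have hη1 : ∀ x, η x ≤ 1 := fun x => h3 x 1 fun y _ => max_le zero_le_one (min_le_left _ _)
  have hd : ∀ x y, dist y x < s / 8 → |infDist x K - infDist y K| ≤ s / 8 := fun x y hy => by
    have := (lipschitz_infDist_pt K).dist_le_mul x y
    rw [NNReal.coe_one, one_mul, Real.dist_eq, dist_comm] at this
    linarith
  refine ⟨η, h1, hη0, hη1, fun x hx => ?_, fun x hx => ?_, fun x => ?_⟩
  · refine le_antisymm (h3 x 0 fun y hy => max_le le_rfl ((min_le_right _ _).trans ?_)) (hη0 x)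
    have := (abs_le.1 (hd x y hy)).1
    rw [sub_nonpos, div_mul_eq_mul_div, div_le_iff₀ hs]
    linarith
  · refine le_antisymm (hη1 x) (h4 x 1 fun y hy => le_max_of_le_right (le_min le_rfl ?_))
    have := (abs_le.1 (hd x y hy)).2
    rw [le_sub_iff_add_le, div_mul_eq_mul_div, le_div_iff₀ hs]
    linarith
  · refine (norm_fderiv_le_of_lipschitz ℝ h2).trans ?_
    rw [Real.coe_toNNReal _ (by positivity)]
    gcongr
    norm_num

/-- A function of class `C¹` that equals one on a large ball and vanishes outside a larger one. -/
lemma exists_cutoff_ball {R : ℝ} (hR : 2 ≤ R) :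
    ∃ χ : E → ℝ, ContDiff ℝ 1 χ ∧ (∀ x, 0 ≤ χ x) ∧ (∀ x, χ x ≤ 1) ∧
      (∀ x, ‖x‖ ≤ R - 1 → χ x = 1) ∧ (∀ x, 3 * R ≤ ‖x‖ → χ x = 0) ∧
      ∀ x, ‖fderiv ℝ χ x‖ ≤ 1 / R := by
  have hR0 : 0 < R := by linarith
  -- The ramp falls from 1 at radius `R` to 0 at radius `2R`; mollification at scale 1 shrinks and
  -- enlarges these radii by at most 1.
  let f : E → ℝ := fun x => max 0 (min 1 (2 - (1 / R) * ‖x‖))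
  have hf : LipschitzWith (Real.toNNReal (1 / R)) f := by
    refine LipschitzWith.const_max (LipschitzWith.const_min ?_ 1) 0
    refine LipschitzWith.of_dist_le_mul fun x y => ?_
    rw [Real.coe_toNNReal _ (by positivity), Real.dist_eq, dist_eq_norm, sub_sub_sub_cancel_left,
      ← mul_sub, abs_mul, abs_of_nonneg (by positivity : 0 ≤ 1 / R), abs_sub_comm]
    gcongr
    exact abs_norm_sub_norm_le x y
  obtain ⟨χ, h1, h2, h3, h4⟩ := exists_contDiff_lipschitzWith hf zero_lt_one
  have hχ0 : ∀ x, 0 ≤ χ x := fun x => h4 x 0 fun y _ => le_max_left _ _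
  have hχ1 : ∀ x, χ x ≤ 1 := fun x => h3 x 1 fun y _ => max_le zero_le_one (min_le_left _ _)
  refine ⟨χ, h1, hχ0, hχ1, fun x hx => ?_, fun x hx => ?_, fun x => ?_⟩
  · refine le_antisymm (hχ1 x) (h4 x 1 fun y hy => le_max_of_le_right (le_min le_rfl ?_))
    rw [mem_ball, dist_eq_norm] at hy
    have := norm_le_norm_add_norm_sub' y x
    have : 1 / R * ‖y‖ ≤ 1 := by rw [one_div, inv_mul_le_iff₀ hR0]; linarith
    linarith
  · refine le_antisymm (h3 x 0 fun y hy => max_le le_rfl ((min_le_right _ _).trans ?_)) (hχ0 x)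
    rw [mem_ball, dist_eq_norm, norm_sub_rev] at hy
    have := norm_le_norm_add_norm_sub' x y
    have : 2 ≤ 1 / R * ‖y‖ := by rw [one_div, le_inv_mul_iff₀ hR0]; linarith
    linarith
  · refine (norm_fderiv_le_of_lipschitz ℝ h2).trans ?_
    rw [Real.coe_toNNReal _ (by positivity)]

end Cutoff

/-! ### Energy forms and near-minimizers -/

section Energy

/-- Bilinear forms on the space of gradients of plane vector fields. -/
abbrev GradientForm : Type := (Plane →L[ℝ] Plane) →L[ℝ] (Plane →L[ℝ] Plane) →L[ℝ] ℝ

/-- Symmetric, coercive and bounded forms. -/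
structure IsElliptic (a : GradientForm) (m N : ℝ) : Prop where
  symm : ∀ F G, a F G = a G F
  pos : 0 < m
  coercive : ∀ F, m * ‖F‖ ^ 2 ≤ a F F
  nonneg : 0 ≤ N
  bound : ∀ F G, |a F G| ≤ N * ‖F‖ * ‖G‖

/-- Continuously differentiable vector fields with compact support in `D`. -/
structure IsAdmissible (D : Set Plane) (v : Plane → Plane) : Prop where
  contDiff : ContDiff ℝ 1 v
  hasCompactSupport : HasCompactSupport v
  tsupport_subset : tsupport v ⊆ D

variable {D : Set Plane} {v w ψ g : Plane → Plane} {a : GradientForm} {m N k ε : ℝ}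

lemma IsAdmissible.continuous_fderiv (hv : IsAdmissible D v) : Continuous (fderiv ℝ v) :=
  hv.contDiff.continuous_fderiv (by norm_num)

lemma IsAdmissible.differentiable (hv : IsAdmissible D v) : Differentiable ℝ v :=
  hv.contDiff.differentiable (by norm_num)

lemma IsAdmissible.eq_zero (hv : IsAdmissible D v) {x : Plane} (hx : x ∉ D) : v x = 0 :=
  image_eq_zero_of_notMem_tsupport fun h => hx (hv.tsupport_subset h)

lemma IsAdmissible.fderiv_eq_zero (hv : IsAdmissible D v) {x : Plane} (hx : x ∉ D) :
    fderiv ℝ v x = 0 :=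
  fderiv_eq_zero_of_notMem_tsupport fun h => hx (hv.tsupport_subset h)

lemma isAdmissible_zero (D : Set Plane) : IsAdmissible D (fun _ => 0) :=
  ⟨contDiff_const, HasCompactSupport.zero, by simp [tsupport]⟩

lemma IsAdmissible.add_smul (hv : IsAdmissible D v) (hw : IsAdmissible D w) (t : ℝ) :
    IsAdmissible D (fun x => v x + t • w x) where
  contDiff := hv.contDiff.add (hw.contDiff.const_smul t)
  hasCompactSupport := hv.hasCompactSupport.add (hw.hasCompactSupport.comp_left (g := fun y => t • y)
    (smul_zero t))
  tsupport_subset := (tsupport_add v fun x => t • w x).trans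
    (union_subset hv.tsupport_subset ((closure_mono fun x hx => by
      simp only [Function.mem_support] at *
      exact fun h => hx (by rw [h, smul_zero])).trans hw.tsupport_subset))

/-- The bilinear energy form. -/
def energy (a : GradientForm) (k : ℝ) (v w : Plane → Plane) : ℝ :=
  ∫ x, (a (fderiv ℝ v x) (fderiv ℝ w x) + k * inner ℝ (v x) (w x))

lemma IsAdmissible.integrable_form (hv : IsAdmissible D v) (hw : IsAdmissible D w)
    (a : GradientForm) : Integrable fun x => a (fderiv ℝ v x) (fderiv ℝ w x) := by
  have h1 := hv.continuous_fderiv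
  have h2 := hw.continuous_fderiv
  refine Continuous.integrable_of_hasCompactSupport (by fun_prop) ?_
  refine (hv.hasCompactSupport.fderiv ℝ).mono fun x hx => ?_
  simp only [Function.mem_support] at *
  exact fun h => hx (by rw [h]; simp)

lemma IsAdmissible.integrable_inner (hv : IsAdmissible D v) (hg : Continuous g) :
    Integrable fun x => (inner ℝ (g x) (v x) : ℝ) := by
  have h1 := hv.contDiff.continuous
  refine Continuous.integrable_of_hasCompactSupport (by fun_prop) ?_
  refine hv.hasCompactSupport.mono fun x hx => ?_
  simp only [Function.mem_support] at *
  exact fun h => hx (by rw [h]; simp)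

lemma IsAdmissible.integrable_energy (hv : IsAdmissible D v) (hw : IsAdmissible D w)
    (a : GradientForm) (k : ℝ) :
    Integrable fun x => a (fderiv ℝ v x) (fderiv ℝ w x) + k * inner ℝ (v x) (w x) :=
  (hv.integrable_form hw a).add ((hw.integrable_inner hv.contDiff.continuous).const_mul k)

lemma IsAdmissible.integrable_norm_sq (hv : IsAdmissible D v) : Integrable fun x => ‖v x‖ ^ 2 := by
  simpa using hv.integrable_inner hv.contDiff.continuous

lemma IsAdmissible.integrable_norm_fderiv_sq (hv : IsAdmissible D v) :
    Integrable fun x => ‖fderiv ℝ v x‖ ^ 2 := by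
  have h1 := hv.continuous_fderiv
  exact Continuous.integrable_of_hasCompactSupport (by fun_prop)
      ((hv.hasCompactSupport.fderiv ℝ).norm.comp_left (g := fun r : ℝ => r ^ 2) (by simp))

lemma energy_add_smul (ha : IsElliptic a m N) (hv : IsAdmissible D v) (hψ : IsAdmissible D ψ) (t : ℝ) :
    energy a k (fun x => v x + t • ψ x) (fun x => v x + t • ψ x) =
      energy a k v v + 2 * t * energy a k v ψ + t ^ 2 * energy a k ψ ψ := by
  have hpt : ∀ x, a (fderiv ℝ (fun x => v x + t • ψ x) x) (fderiv ℝ (fun x => v x + t • ψ x) x) +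
      k * inner ℝ (v x + t • ψ x) (v x + t • ψ x) =
      (a (fderiv ℝ v x) (fderiv ℝ v x) + k * inner ℝ (v x) (v x)) +
      2 * t * (a (fderiv ℝ v x) (fderiv ℝ ψ x) + k * inner ℝ (v x) (ψ x)) +
      t ^ 2 * (a (fderiv ℝ ψ x) (fderiv ℝ ψ x) + k * inner ℝ (ψ x) (ψ x)) := fun x => by
    have hd : fderiv ℝ (fun x => v x + t • ψ x) x = fderiv ℝ v x + t • fderiv ℝ ψ x :=
      ((hv.differentiable x).hasFDerivAt.add ((hψ.differentiable x).hasFDerivAt.const_smul t)).fderiv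
    rw [hd]
    simp only [map_add, map_smul, add_apply, smul_apply, smul_eq_mul,
      inner_add_left, inner_add_right, inner_smul_left, inner_smul_right, ha.symm (fderiv ℝ ψ x)
      (fderiv ℝ v x), real_inner_comm (v x) (ψ x)]
    simp
    ring
  simp only [energy]
  simp_rw [hpt]
  rw [integral_add, integral_add, integral_const_mul, integral_const_mul]
  · exact hv.integrable_energy hv a k
  · exact (hv.integrable_energy hψ a k).const_mul _
  · exact (hv.integrable_energy hv a k).add ((hv.integrable_energy hψ a k).const_mul _)
  · exact (hψ.integrable_energy hψ a k).const_mul _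

/-- The energy functional whose minimizer is the weak solution with right-hand side `g`. -/
def functional (a : GradientForm) (k : ℝ) (g v : Plane → Plane) : ℝ :=
  energy a k v v / 2 - ∫ x, (inner ℝ (g x) (v x) : ℝ)

lemma functional_add_smul (ha : IsElliptic a m N) (hg : Continuous g) (hv : IsAdmissible D v)
    (hψ : IsAdmissible D ψ) (t : ℝ) :
    functional a k g (fun x => v x + t • ψ x) = functional a k g v +
      t * (energy a k v ψ - ∫ x, (inner ℝ (g x) (ψ x) : ℝ)) + t ^ 2 / 2 * energy a k ψ ψ := by
  simp only [functional]
  rw [energy_add_smul ha hv hψ]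
  simp_rw [inner_add_right, inner_smul_right]
  rw [integral_add (hv.integrable_inner hg) ((hψ.integrable_inner hg).const_mul t),
    integral_const_mul]
  ring

/-- Minimizers of the energy functional up to `ε`. -/
structure IsNearMinimizer (a : GradientForm) (k : ℝ) (D : Set Plane) (g : Plane → Plane) (ε : ℝ)
    (v : Plane → Plane) : Prop where
  isAdmissible : IsAdmissible D v
  le : ∀ ψ, IsAdmissible D ψ → functional a k g v ≤ functional a k g ψ + ε

lemma integral_norm_fderiv_sq_le_energy (ha : IsElliptic a m N) (hk : 0 ≤ k) (hv : IsAdmissible D v) :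
    m * ∫ x, ‖fderiv ℝ v x‖ ^ 2 ≤ energy a k v v := by
  rw [← integral_const_mul]
  refine integral_mono (hv.integrable_norm_fderiv_sq.const_mul m) (hv.integrable_energy hv a k)
    fun x => ?_
  have h1 := ha.coercive (fderiv ℝ v x)
  have h2 : 0 ≤ k * inner ℝ (v x) (v x) := mul_nonneg hk real_inner_self_nonneg
  linarith

lemma integral_norm_sq_le_energy (ha : IsElliptic a m N) (hv : IsAdmissible D v) :
    k * ∫ x, ‖v x‖ ^ 2 ≤ energy a k v v := by
  rw [← integral_const_mul]
  refine integral_mono (hv.integrable_norm_sq.const_mul k) (hv.integrable_energy hv a k)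
    fun x => ?_
  have h1 := ha.coercive (fderiv ℝ v x)
  have h2 : 0 ≤ m * ‖fderiv ℝ v x‖ ^ 2 := mul_nonneg ha.pos.le (sq_nonneg _)
  rw [real_inner_self_eq_norm_sq]
  linarith

lemma energy_self_nonneg (ha : IsElliptic a m N) (hk : 0 ≤ k) (hv : IsAdmissible D v) :
    0 ≤ energy a k v v :=
  (mul_nonneg hk (integral_nonneg fun _ => sq_nonneg _)).trans (integral_norm_sq_le_energy ha hv)

/-- Young's inequality, weighted so that the `v` term is at most a quarter of the energy and is
absorbed by the `1/2` in `functional`. -/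
lemma integral_inner_le (hk : 0 < k) (hg : Continuous g) (hgc : HasCompactSupport g)
    (hv : IsAdmissible D v) : ∫ x, (inner ℝ (g x) (v x) : ℝ) ≤
      k / 4 * (∫ x, ‖v x‖ ^ 2) + k⁻¹ * ∫ x, ‖g x‖ ^ 2 := by
  have hgi : Integrable fun x => ‖g x‖ ^ 2 :=
    Continuous.integrable_of_hasCompactSupport (by fun_prop)
      (hgc.norm.comp_left (g := fun r : ℝ => r ^ 2) (by simp))
  rw [← integral_const_mul, ← integral_const_mul,
    ← integral_add (hv.integrable_norm_sq.const_mul _) (hgi.const_mul _)]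
  refine integral_mono (hv.integrable_inner hg)
    ((hv.integrable_norm_sq.const_mul _).add (hgi.const_mul _)) fun x => ?_
  refine (real_inner_le_norm _ _).trans ?_
  have h1 : 0 ≤ k⁻¹ * (‖g x‖ - k / 2 * ‖v x‖) ^ 2 := by positivity
  have h2 : k⁻¹ * (‖g x‖ - k / 2 * ‖v x‖) ^ 2 =
      k⁻¹ * ‖g x‖ ^ 2 - ‖g x‖ * ‖v x‖ + k / 4 * ‖v x‖ ^ 2 := by
    field_simp
    ring
  linarith

/-- Fields that come within `ε` of the infimum suffice for the argument, so no Sobolev completion is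
formed and all competitors stay `C¹` with compact support in `D`. -/
lemma exists_isNearMinimizer (ha : IsElliptic a m N) (hk : 0 < k) (hg : Continuous g)
    (hgc : HasCompactSupport g) (D : Set Plane) (hε : 0 < ε) :
    ∃ v, IsNearMinimizer a k D g ε v := by
  let S : Set ℝ := {j | ∃ v, IsAdmissible D v ∧ functional a k g v = j}
  have hne : S.Nonempty := ⟨_, _, isAdmissible_zero D, rfl⟩
  have hbdd : BddBelow S := by
    refine ⟨-(k⁻¹ * ∫ x, ‖g x‖ ^ 2), ?_⟩
    rintro _ ⟨v, hv, rfl⟩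
    have h1 := integral_inner_le hk hg hgc hv
    have h2 := integral_norm_sq_le_energy (k := k) ha hv
    have h3 := energy_self_nonneg ha hk.le hv
    simp only [functional]
    linarith
  obtain ⟨_, ⟨v, hv, rfl⟩, hlt⟩ := exists_lt_of_csInf_lt hne (show sInf S < sInf S + ε by linarith)
  exact ⟨v, hv, fun ψ hψ => hlt.le.trans (by have := csInf_le hbdd ⟨ψ, hψ, rfl⟩; linarith)⟩

namespace IsNearMinimizer

lemma energy_le (hv : IsNearMinimizer a k D g ε v) (ha : IsElliptic a m N) (hk : 0 < k)
    (hg : Continuous g) (hgc : HasCompactSupport g) :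
    energy a k v v ≤ 4 * ε + 4 * (k⁻¹ * ∫ x, ‖g x‖ ^ 2) := by
  have h0 := hv.le _ (isAdmissible_zero D)
  have h1 := integral_inner_le hk hg hgc hv.isAdmissible
  have h2 := integral_norm_sq_le_energy (k := k) ha hv.isAdmissible
  have h3 : functional a k g (fun _ => 0) = 0 := by simp [functional, energy]
  rw [h3, functional] at h0
  linarith

/-- This is the weak equation up to an error of order `√ε`: the quadratic polynomial `t ↦ functional
(v + tψ) - functional v + ε` is nonnegative, so its discriminant is not positive. -/
lemma sq_le (hv : IsNearMinimizer a k D g ε v) (ha : IsElliptic a m N) (hg : Continuous g)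
    (hψ : IsAdmissible D ψ) :
    (energy a k v ψ - ∫ x, (inner ℝ (g x) (ψ x) : ℝ)) ^ 2 ≤ 2 * ε * energy a k ψ ψ := by
  have h := discrim_le_zero (a := energy a k ψ ψ / 2)
    (b := energy a k v ψ - ∫ x, (inner ℝ (g x) (ψ x) : ℝ)) (c := ε) fun t => by
      have h1 := hv.le _ (hv.isAdmissible.add_smul hψ t)
      rw [functional_add_smul ha hg hv.isAdmissible hψ] at h1
      nlinarith
  rw [discrim] at h
  linarith

/-- Uniform convexity: near-minimality is tested at the midpoint of `v` and `w`, and the linear term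
is eliminated using the exact expansion at `w`. -/
lemma energy_sub_le (hv : IsNearMinimizer a k D g ε v) (ha : IsElliptic a m N) (hg : Continuous g)
    (hw : IsAdmissible D w) :
    energy a k (fun x => w x + (-1 : ℝ) • v x) (fun x => w x + (-1 : ℝ) • v x) ≤
      4 * (functional a k g w - functional a k g v) + 8 * ε := by
  have hψ := hw.add_smul hv.isAdmissible (-1)
  have h1 := functional_add_smul (k := k) ha hg hv.isAdmissible hψ 1
  have h2 := hv.le _ (hv.isAdmissible.add_smul hψ (1 / 2))
  rw [functional_add_smul ha hg hv.isAdmissible hψ] at h2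
  have h3 : (fun x => v x + (1 : ℝ) • (w x + (-1 : ℝ) • v x)) = w := by
    funext x; simp
  rw [h3] at h1
  linarith

end IsNearMinimizer

end Energy

/-! ### Energy of shifted fields and gradient decay in strips -/

section ShiftEnergy

variable {D : Set Plane} {v g ξ : Plane → Plane} {a : GradientForm} {m N k ε : ℝ}

lemma isAdmissible_comp_shift (hv : IsAdmissible D v) (hξ : ContDiff ℝ 1 ξ)
    (hξc : HasCompactSupport ξ) {h : ℝ} (hpush : ∀ x ∈ Dᶜ, x - h • ξ x ∈ Dᶜ) :
    IsAdmissible D fun x => v (x - h • ξ x) where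
  contDiff := hv.contDiff.comp (contDiff_id.sub (hξ.const_smul h))
  hasCompactSupport := by
    refine HasCompactSupport.of_support_subset_isCompact
      (hv.hasCompactSupport.isCompact.union hξc.isCompact) fun x hx => ?_
    by_cases hξx : ξ x = 0
    · exact Or.inl (subset_tsupport v (by simpa [hξx] using hx))
    · exact Or.inr (subset_tsupport ξ hξx)
  tsupport_subset := by
    have hc : Continuous fun x => x - h • ξ x := by have := hξ.continuous; fun_prop
    have h1 : tsupport (fun x => v (x - h • ξ x)) ⊆ (fun x => x - h • ξ x) ⁻¹' tsupport v :=
      closure_minimal (fun x hx => subset_tsupport v hx) ((isClosed_tsupport v).preimage hc)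
    intro x hx
    by_contra hxD
    exact hpush x hxD (hv.tsupport_subset (h1 hx))

/-- The first- and second-order terms in `h` are at most `2hNL‖F‖²` and `hNL‖F‖²`, the latter
because `hL ≤ 1`. Coercivity converts `‖F‖²` into `a F F / m`. -/
lemma form_comp_shift_le (ha : IsElliptic a m N) (F A : Plane →L[ℝ] Plane) {L h : ℝ} (hA : ‖A‖ ≤ L)
    (hh : 0 ≤ h) (hL : h * L ≤ 1) :
    a (F.comp (ContinuousLinearMap.id ℝ Plane - h • A))
      (F.comp (ContinuousLinearMap.id ℝ Plane - h • A)) ≤ (1 + 3 * N * L / m * h) * a F F := by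
  have hm := ha.pos
  have hN := ha.nonneg
  have hL0 : 0 ≤ L := (norm_nonneg _).trans hA
  have h1 : F.comp (ContinuousLinearMap.id ℝ Plane - h • A) = F - h • F.comp A := by
    ext x; simp
  have hX : ‖F.comp A‖ ≤ ‖F‖ * L := (F.opNorm_comp_le A).trans (by gcongr)
  have h2 : a (F - h • F.comp A) (F - h • F.comp A) =
      a F F - 2 * h * a F (F.comp A) + h ^ 2 * a (F.comp A) (F.comp A) := by
    simp [ha.symm (F.comp A) F]
    ring
  have h3 : -a F (F.comp A) ≤ N * ‖F‖ * (‖F‖ * L) :=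
    (neg_le_abs _).trans ((ha.bound _ _).trans (by gcongr))
  have h4 : a (F.comp A) (F.comp A) ≤ N * (‖F‖ * L) * (‖F‖ * L) :=
    (le_abs_self _).trans ((ha.bound _ _).trans (by gcongr))
  have h5 : h ^ 2 * a (F.comp A) (F.comp A) ≤ h * (N * L * ‖F‖ ^ 2) := by
    calc h ^ 2 * a (F.comp A) (F.comp A) ≤ h ^ 2 * (N * (‖F‖ * L) * (‖F‖ * L)) := by gcongr
      _ = h * (N * L * ‖F‖ ^ 2) * (h * L) := by ring
      _ ≤ h * (N * L * ‖F‖ ^ 2) * 1 := by gcongr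
      _ = _ := mul_one _
  have h6 : 3 * h * N * L * ‖F‖ ^ 2 ≤ 3 * N * L / m * h * a F F := by
    calc 3 * h * N * L * ‖F‖ ^ 2 = 3 * N * L / m * h * (m * ‖F‖ ^ 2) := by field_simp
      _ ≤ _ := by gcongr; exact ha.coercive F
  have h7 : 2 * h * -a F (F.comp A) ≤ 2 * h * (N * ‖F‖ * (‖F‖ * L)) := by gcongr
  rw [h1, h2]
  nlinarith

/-- One factor `1 + O(h)` comes from the chain rule, the other from the Jacobian. The condition `8hL
≤ 1` absorbs the cross term at the price of doubling `3NL/m`. -/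
lemma energy_comp_shift_le (ha : IsElliptic a m N) (hk : 0 ≤ k) (hv : IsAdmissible D v)
    (hξ : ContDiff ℝ 1 ξ) (hξc : HasCompactSupport ξ) {L : NNReal} (hL : LipschitzWith L ξ) {h : ℝ}
    (hh : 0 ≤ h) (hhL : 8 * (h * L) ≤ 1) (hpush : ∀ x ∈ Dᶜ, x - h • ξ x ∈ Dᶜ) :
    energy a k (fun x => v (x - h • ξ x)) (fun x => v (x - h • ξ x)) ≤
      (1 + (6 * N * L / m + 8 * L) * h) * energy a k v v := by
  have hm := ha.pos
  have hN := ha.nonneg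
  have hhL0 : 0 ≤ h * L := by positivity
  set c : ℝ := 3 * N * L / m with hc
  have hc0 : 0 ≤ c := by positivity
  set G : Plane → ℝ := fun x => a (fderiv ℝ v x) (fderiv ℝ v x) + k * inner ℝ (v x) (v x) with hG
  have hG0 : ∀ x, 0 ≤ G x := fun x => add_nonneg
    ((mul_nonneg hm.le (sq_nonneg _)).trans (ha.coercive _)) (mul_nonneg hk real_inner_self_nonneg)
  have hGc : Continuous G := by
    have h1 := hv.continuous_fderiv
    have h2 := hv.contDiff.continuous
    fun_prop
  have hGi : Integrable G := hv.integrable_energy hv a k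
  have hvs := isAdmissible_comp_shift hv hξ hξc hpush
  have hGsi : Integrable fun x => G (x - h • ξ x) := by
    have hcξ := hξ.continuous
    refine Continuous.integrable_of_hasCompactSupport (by fun_prop) ?_
    refine HasCompactSupport.of_support_subset_isCompact
      (hv.hasCompactSupport.isCompact.union hξc.isCompact) fun x hx => ?_
    by_contra hx'
    rw [mem_union, not_or] at hx'
    refine hx ?_
    simp [hG, image_eq_zero_of_notMem_tsupport hx'.2, image_eq_zero_of_notMem_tsupport hx'.1,
      fderiv_eq_zero_of_notMem_tsupport hx'.1]
  calc energy a k (fun x => v (x - h • ξ x)) (fun x => v (x - h • ξ x))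
      ≤ ∫ x, (1 + c * h) * G (x - h • ξ x) := by
        refine integral_mono (hvs.integrable_energy hvs a k) (hGsi.const_mul _) fun x => ?_
        have hd : fderiv ℝ (fun x => v (x - h • ξ x)) x = (fderiv ℝ v (x - h • ξ x)).comp
            (ContinuousLinearMap.id ℝ Plane - h • fderiv ℝ ξ x) :=
          ((hv.differentiable _).hasFDerivAt.comp x (hasFDerivAt_shift hξ h x)).fderiv
        have h1 := form_comp_shift_le ha (fderiv ℝ v (x - h • ξ x)) (fderiv ℝ ξ x)
          (norm_fderiv_le_of_lipschitz ℝ hL) hh (by linarith)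
        have h2 : 0 ≤ k * inner ℝ (v (x - h • ξ x)) (v (x - h • ξ x)) :=
          mul_nonneg hk real_inner_self_nonneg
        have h3 : 0 ≤ c * h := by positivity
        simp only [hd, hG]
        nlinarith
    _ = (1 + c * h) * ∫ x, G (x - h • ξ x) := integral_const_mul _ _
    _ ≤ (1 + c * h) * ((1 + 8 * L * h) * ∫ x, G x) := by
        gcongr
        exact integral_comp_shift_le hξ hL hh hhL hGc hG0 hGi
    _ = ((1 + c * h) * (1 + 8 * L * h)) * energy a k v v := by rw [mul_assoc (1 + c * h)]; rfl
    _ ≤ _ := by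
        refine mul_le_mul_of_nonneg_right ?_ (energy_self_nonneg ha hk hv)
        have h3 : 0 ≤ c * h := by positivity
        have : 6 * N * L / m = 2 * c := by rw [hc]; ring
        rw [this]
        nlinarith

/-- Near-minimizers have small gradient energy in thin strips along the boundary: compare them with
their own shift, which vanishes in the strip. -/
theorem IsNearMinimizer.integral_strip_le (hv : IsNearMinimizer a k D g ε v) (ha : IsElliptic a m N)
    (hk : 0 ≤ k) (hD : IsOpen D) (hg : Continuous g) (hξ : ContDiff ℝ 1 ξ)
    (hξc : HasCompactSupport ξ) (hgξ : ∀ x, g x ≠ 0 → ξ x = 0)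
    {L : NNReal} (hL : LipschitzWith L ξ) {h s : ℝ}
    (hh : 0 ≤ h) (hs : 0 ≤ s) (hhL : 8 * (h * L) ≤ 1)
    (hpush : ∀ x, infDist x Dᶜ ≤ s → x - h • ξ x ∈ Dᶜ) :
    m * ∫ x in strip D s, ‖fderiv ℝ v x‖ ^ 2 ≤
      2 * ((6 * N * L / m + 8 * L) * h) * energy a k v v + 8 * ε := by
  have hpush' : ∀ x ∈ Dᶜ, x - h • ξ x ∈ Dᶜ := fun x hx =>
    hpush x (by rw [infDist_zero_of_mem hx]; exact hs)
  have hvs := isAdmissible_comp_shift hv.isAdmissible hξ hξc hpush'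
  have hE := energy_comp_shift_le (k := k) ha hk hv.isAdmissible hξ hξc hL hh hhL hpush'
  have hfun : functional a k g (fun x => v (x - h • ξ x)) - functional a k g v ≤
      (6 * N * L / m + 8 * L) * h * energy a k v v / 2 := by
    -- The load is supported where `ξ` vanishes, so the linear part of the functional does not see
    -- the shift.
    have : ∀ x, (inner ℝ (g x) (v (x - h • ξ x)) : ℝ) = inner ℝ (g x) (v x) := fun x => by
      by_cases hx : g x = 0
      · simp [hx]
      · simp [hgξ x hx]
    simp only [functional, this]
    linarith
  have hsub := hv.energy_sub_le ha hg hvs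
  have hw := hvs.add_smul hv.isAdmissible (-1)
  set w : Plane → Plane := fun x => v (x - h • ξ x) + (-1 : ℝ) • v x with hwdef
  -- On the strip the shifted field has zero gradient, because its argument has been pushed into
  -- `Dᶜ`; there `∇w = -∇v`.
  have hpt : ∀ x ∈ strip D s, ‖fderiv ℝ v x‖ ^ 2 = ‖fderiv ℝ w x‖ ^ 2 := fun x hx => by
    have h1 : fderiv ℝ w x = fderiv ℝ (fun x => v (x - h • ξ x)) x + (-1 : ℝ) • fderiv ℝ v x :=
      ((hvs.differentiable x).hasFDerivAt.add
        ((hv.isAdmissible.differentiable x).hasFDerivAt.const_smul (-1 : ℝ))).fderiv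
    have hd : fderiv ℝ (fun x => v (x - h • ξ x)) x = (fderiv ℝ v (x - h • ξ x)).comp
        (ContinuousLinearMap.id ℝ Plane - h • fderiv ℝ ξ x) :=
      ((hv.isAdmissible.differentiable _).hasFDerivAt.comp x (hasFDerivAt_shift hξ h x)).fderiv
    rw [h1, hd, hv.isAdmissible.fderiv_eq_zero (hpush x hx.2)]
    rw [ContinuousLinearMap.zero_comp, zero_add, norm_smul, norm_neg, norm_one, one_mul]
  rw [setIntegral_congr_fun (measurableSet_strip hD s) hpt]
  calc m * ∫ x in strip D s, ‖fderiv ℝ w x‖ ^ 2 ≤ m * ∫ x, ‖fderiv ℝ w x‖ ^ 2 := by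
        refine mul_le_mul_of_nonneg_left ?_ ha.pos.le
        exact setIntegral_le_integral hw.integrable_norm_fderiv_sq (ae_of_all _ fun _ => sq_nonneg _)
    _ ≤ energy a k w w := integral_norm_fderiv_sq_le_energy ha hk hw
    _ ≤ _ := by linarith

end ShiftEnergy

/-! ### The Lamé form and its coercivity -/

section LameForm

lemma norm_sq_le_sum_apply_single (F : Plane →L[ℝ] Plane) :
    ‖F‖ ^ 2 ≤ ∑ i, ∑ j, F (EuclideanSpace.single j 1) i ^ 2 := by
  set S := ∑ i, ∑ j, F (EuclideanSpace.single j 1) i ^ 2 with hS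
  have hS0 : 0 ≤ S := Finset.sum_nonneg fun _ _ => Finset.sum_nonneg fun _ _ => sq_nonneg _
  have h : ‖F‖ ≤ √S := by
    refine F.opNorm_le_bound (Real.sqrt_nonneg _) fun x => ?_
    refine le_of_sq_le_sq ?_ (by positivity)
    rw [mul_pow, Real.sq_sqrt hS0, EuclideanSpace.real_norm_sq_eq, EuclideanSpace.real_norm_sq_eq]
    have hx : x = x 0 • EuclideanSpace.single 0 (1 : ℝ) + x 1 • EuclideanSpace.single 1 (1 : ℝ) := by
      ext i; fin_cases i <;> simp
    have hF : ∀ i, F x i = x 0 * F (EuclideanSpace.single 0 1) i +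
        x 1 * F (EuclideanSpace.single 1 1) i := fun i => by
      conv_lhs => rw [hx]
      simp
    simp only [hS, Fin.sum_univ_two, hF]
    set p := F (EuclideanSpace.single 0 1) 0
    set q := F (EuclideanSpace.single 1 1) 0
    set r := F (EuclideanSpace.single 0 1) 1
    set s := F (EuclideanSpace.single 1 1) 1
    nlinarith [sq_nonneg (x 0 * q - x 1 * p), sq_nonneg (x 0 * s - x 1 * r)]
  calc ‖F‖ ^ 2 ≤ √S ^ 2 := by gcongr
    _ = S := Real.sq_sqrt hS0

/-- The elastic energy density, augmented by a multiple `t` of the null Lagrangian `2 det`. -/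
def lameForm (cs cp t : ℝ) : GradientForm :=
  (LinearMap.mk₂ ℝ (fun F G : Plane →L[ℝ] Plane =>
    cs * ∑ i, ∑ j, F (EuclideanSpace.single j 1) i * G (EuclideanSpace.single j 1) i +
    (cp - cs) * ((∑ i, F (EuclideanSpace.single i 1) i) * ∑ i, G (EuclideanSpace.single i 1) i) +
    t * (F (EuclideanSpace.single 0 1) 0 * G (EuclideanSpace.single 1 1) 1 +
      F (EuclideanSpace.single 1 1) 1 * G (EuclideanSpace.single 0 1) 0 -
      F (EuclideanSpace.single 1 1) 0 * G (EuclideanSpace.single 0 1) 1 -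
      F (EuclideanSpace.single 0 1) 1 * G (EuclideanSpace.single 1 1) 0))
    (fun _ _ _ => by simp [Fin.sum_univ_two]; ring) (fun _ _ _ => by simp [Fin.sum_univ_two]; ring)
    (fun _ _ _ => by simp [Fin.sum_univ_two]; ring)
    (fun _ _ _ => by simp [Fin.sum_univ_two]; ring)).toContinuousBilinearMap

lemma lameForm_apply (cs cp t : ℝ) (F G : Plane →L[ℝ] Plane) : lameForm cs cp t F G =
    cs * ∑ i, ∑ j, F (EuclideanSpace.single j 1) i * G (EuclideanSpace.single j 1) i +
    (cp - cs) * ((∑ i, F (EuclideanSpace.single i 1) i) * ∑ i, G (EuclideanSpace.single i 1) i) +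
    t * (F (EuclideanSpace.single 0 1) 0 * G (EuclideanSpace.single 1 1) 1 +
      F (EuclideanSpace.single 1 1) 1 * G (EuclideanSpace.single 0 1) 0 -
      F (EuclideanSpace.single 1 1) 0 * G (EuclideanSpace.single 0 1) 1 -
      F (EuclideanSpace.single 0 1) 1 * G (EuclideanSpace.single 1 1) 0) := rfl

/-- Here `cs` and `cp` stand for the squared velocities. With `t = cs - m` the form at `F` equals
`m|F|² + (cp - m)(tr F)² + (cs - m)(F₀₁ - F₁₀)²`, where `|F|` is the Hilbert–Schmidt norm, which
dominates the operator norm. -/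
lemma isElliptic_lameForm {cs cp m : ℝ} (hm : 0 < m) (hs : m ≤ cs) (hp : m ≤ cp) :
    IsElliptic (lameForm cs cp (cs - m)) m (4 * |cs| + 4 * |cp - cs| + 4 * |cs - m|) where
  symm F G := by
    simp only [lameForm_apply, Fin.sum_univ_two]
    ring
  pos := hm
  coercive F := by
    refine (mul_le_mul_of_nonneg_left (norm_sq_le_sum_apply_single F) hm.le).trans ?_
    simp only [lameForm_apply, Fin.sum_univ_two]
    set p := F (EuclideanSpace.single 0 1) 0
    set q := F (EuclideanSpace.single 1 1) 0
    set r := F (EuclideanSpace.single 0 1) 1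
    set s := F (EuclideanSpace.single 1 1) 1
    have h1 : 0 ≤ (cp - m) * (p + s) ^ 2 := mul_nonneg (by linarith) (sq_nonneg _)
    have h2 : 0 ≤ (cs - m) * (q - r) ^ 2 := mul_nonneg (by linarith) (sq_nonneg _)
    linarith
  nonneg := by positivity
  bound F G := by
    rw [lameForm_apply]
    have hFG : ∀ i j k l, |F (EuclideanSpace.single j 1) i * G (EuclideanSpace.single l 1) k| ≤
        ‖F‖ * ‖G‖ := fun i j k l => by
      rw [abs_mul]
      exact mul_le_mul (abs_apply_single_le F i j) (abs_apply_single_le G k l) (abs_nonneg _)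
        (norm_nonneg _)
    have hF : ∀ i j k l, -(‖F‖ * ‖G‖) ≤
        F (EuclideanSpace.single j 1) i * G (EuclideanSpace.single l 1) k ∧
        F (EuclideanSpace.single j 1) i * G (EuclideanSpace.single l 1) k ≤ ‖F‖ * ‖G‖ :=
      fun i j k l => abs_le.1 (hFG i j k l)
    have h1 : ∀ c y : ℝ, |y| ≤ 4 * (‖F‖ * ‖G‖) → |c * y| ≤ 4 * |c| * (‖F‖ * ‖G‖) := fun c y hy => by
      rw [abs_mul]
      nlinarith [abs_nonneg c]
    refine (abs_add_three _ _ _).trans ?_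
    have e1 := h1 cs (∑ i, ∑ j, F (EuclideanSpace.single j 1) i * G (EuclideanSpace.single j 1) i) (by
      simp only [Fin.sum_univ_two]
      rw [abs_le]
      constructor <;> linarith [hF 0 0 0 0, hF 0 1 0 1, hF 1 0 1 0, hF 1 1 1 1])
    have e2 := h1 (cp - cs) ((∑ i, F (EuclideanSpace.single i 1) i) *
        ∑ i, G (EuclideanSpace.single i 1) i) (by
      simp only [Fin.sum_univ_two]
      rw [abs_le]
      constructor <;> linarith [hF 0 0 0 0, hF 0 0 1 1, hF 1 1 0 0, hF 1 1 1 1])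
    have e3 := h1 (cs - m) (F (EuclideanSpace.single 0 1) 0 * G (EuclideanSpace.single 1 1) 1 +
      F (EuclideanSpace.single 1 1) 1 * G (EuclideanSpace.single 0 1) 0 -
      F (EuclideanSpace.single 1 1) 0 * G (EuclideanSpace.single 0 1) 1 -
      F (EuclideanSpace.single 0 1) 1 * G (EuclideanSpace.single 1 1) 0) (by
      rw [abs_le]
      constructor <;> linarith [hF 0 0 1 1, hF 1 1 0 0, hF 0 1 1 0, hF 1 0 0 1])
    linarith

lemma gradient_apply {f : Plane → ℝ} (x : Plane) (i : Fin 2) :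
    (∇ f x) i = fderiv ℝ f x (EuclideanSpace.single i 1) := by
  have h : inner ℝ (∇ f x) (EuclideanSpace.single i (1 : ℝ)) =
      fderiv ℝ f x (EuclideanSpace.single i 1) := by
    rw [gradient, InnerProductSpace.toDual_symm_apply]
  rw [← h, EuclideanSpace.inner_single_right]
  simp

lemma fderiv_divergence_apply {u : Plane → Plane} {x : Plane} (hu : ContDiffAt ℝ 2 u x)
    (y : Plane) : fderiv ℝ (divergence u) x y =
      ∑ i, (fderiv ℝ (fderiv ℝ u) x y) (EuclideanSpace.single i 1) i := by
  have hd : HasFDerivAt (fderiv ℝ u) (fderiv ℝ (fderiv ℝ u) x) x :=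
    ((hu.fderiv_right (m := 1) (by norm_num)).differentiableAt (by norm_num)).hasFDerivAt
  have h1 : ∀ i : Fin 2, HasFDerivAt (fun z => fderiv ℝ u z (EuclideanSpace.single i 1) i)
      ((EuclideanSpace.proj i : Plane →L[ℝ] ℝ).comp
        ((ContinuousLinearMap.apply ℝ Plane (EuclideanSpace.single i (1 : ℝ))).comp
          (fderiv ℝ (fderiv ℝ u) x))) x := fun i =>
    (EuclideanSpace.proj i : Plane →L[ℝ] ℝ).hasFDerivAt.comp x
      ((ContinuousLinearMap.apply ℝ Plane (EuclideanSpace.single i (1 : ℝ))).hasFDerivAt.comp x hd)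
  have h2 := HasFDerivAt.fun_sum (u := Finset.univ) fun i _ => h1 i
  have h3 : fderiv ℝ (divergence u) x = _ := h2.fderiv
  rw [h3]
  simp

lemma lameOperator_apply (lam mu rho : ℝ) {u : Plane → Plane} {x : Plane} (hu : ContDiffAt ℝ 2 u x)
    (i : Fin 2) : lameOperator lam mu rho u x i =
      shearVelocity mu rho ^ 2 * ∑ j, (fderiv ℝ (fderiv ℝ u) x (EuclideanSpace.single j 1))
        (EuclideanSpace.single j 1) i +
      (pressureVelocity lam mu rho ^ 2 - shearVelocity mu rho ^ 2) *
        ∑ j, (fderiv ℝ (fderiv ℝ u) x (EuclideanSpace.single i 1)) (EuclideanSpace.single j 1) j := by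
  rw [lameOperator, InnerProductSpace.laplacian_eq_iteratedFDeriv_orthonormalBasis u
    (EuclideanSpace.basisFun (Fin 2) ℝ)]
  simp only [iteratedFDeriv_two_apply, PiLp.add_apply, PiLp.smul_apply, smul_eq_mul,
    gradient_apply, fderiv_divergence_apply hu, EuclideanSpace.basisFun_apply, Fin.sum_univ_two]
  simp

lemma lameOperator_congr (lam mu rho : ℝ) {u v w : Plane → Plane} {x : Plane}
    (hu : ContDiffAt ℝ 2 u x) (hv : ContDiffAt ℝ 2 v x) (hw : w =ᶠ[𝓝 x] fun y => u y - v y) :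
    lameOperator lam mu rho w x = lameOperator lam mu rho u x - lameOperator lam mu rho v x := by
  have hw2 : ContDiffAt ℝ 2 w x := (hu.sub hv).congr_of_eventuallyEq hw
  have hdu : ∀ᶠ y in 𝓝 x, DifferentiableAt ℝ u y :=
    (hu.eventually (by simp)).mono fun y hy => hy.differentiableAt (by norm_num)
  have hdv : ∀ᶠ y in 𝓝 x, DifferentiableAt ℝ v y :=
    (hv.eventually (by simp)).mono fun y hy => hy.differentiableAt (by norm_num)
  have h1 : fderiv ℝ w =ᶠ[𝓝 x] fun y => fderiv ℝ u y - fderiv ℝ v y := by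
    filter_upwards [hw.eventuallyEq_nhds, hdu, hdv] with y hy hyu hyv
    rw [hy.fderiv_eq]
    exact fderiv_sub hyu hyv
  have h2 : fderiv ℝ (fderiv ℝ w) x = fderiv ℝ (fderiv ℝ u) x - fderiv ℝ (fderiv ℝ v) x := by
    rw [h1.fderiv_eq]
    exact fderiv_sub
      ((hu.fderiv_right (m := 1) (by norm_num)).differentiableAt (by norm_num))
      ((hv.fderiv_right (m := 1) (by norm_num)).differentiableAt (by norm_num))
  ext i
  rw [PiLp.sub_apply, lameOperator_apply _ _ _ hu, lameOperator_apply _ _ _ hv,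
    lameOperator_apply _ _ _ hw2, h2]
  simp only [Fin.sum_univ_two, sub_apply, PiLp.sub_apply]
  ring

/-- The rank-one gradient `y ↦ y j • p`. -/
def rankOne (j : Fin 2) : Plane →L[ℝ] (Plane →L[ℝ] Plane) :=
  ContinuousLinearMap.smulRightL ℝ Plane Plane (EuclideanSpace.proj j)

lemma rankOne_apply (j : Fin 2) (p y : Plane) : rankOne j p y = y j • p := rfl

lemma sum_rankOne (F : Plane →L[ℝ] Plane) :
    ∑ j, rankOne j (F (EuclideanSpace.single j 1)) = F := by
  ext y i
  have hy : y = y 0 • EuclideanSpace.single 0 (1 : ℝ) + y 1 • EuclideanSpace.single 1 (1 : ℝ) := by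
    ext i; fin_cases i <;> simp
  conv_rhs => rw [hy]
  simp [Fin.sum_univ_two, rankOne_apply]

/-- The determinant part contributes only differences of mixed second derivatives, so symmetry of
the second derivative removes `t`. This is why the coercive form yields the same equation. -/
lemma sum_lameForm_rankOne (lam mu rho t : ℝ) {u : Plane → Plane} {x : Plane}
    (hu : ContDiffAt ℝ 2 u x) (p : Plane) :
    ∑ j, lameForm (shearVelocity mu rho ^ 2) (pressureVelocity lam mu rho ^ 2) t
      (fderiv ℝ (fderiv ℝ u) x (EuclideanSpace.single j 1)) (rankOne j p) =
      inner ℝ (lameOperator lam mu rho u x) p := by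
  have hsymm : ∀ a b, fderiv ℝ (fderiv ℝ u) x a b = fderiv ℝ (fderiv ℝ u) x b a := fun a b =>
    (hu.isSymmSndFDerivAt (by simp)).eq a b
  have h01 := hsymm (EuclideanSpace.single 0 1) (EuclideanSpace.single 1 1)
  simp only [lameForm_apply, PiLp.inner_apply, lameOperator_apply lam mu rho hu, Fin.sum_univ_two,
    rankOne_apply, h01]
  simp
  ring

end LameForm

/-! ### Integration by parts and the weak equation -/

section WeakEquation

lemma integrable_of_continuousOn_of_eq_zero {D K : Set Plane} (hD : IsOpen D) (hK : IsCompact K)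
    (hKD : K ⊆ D) {f : Plane → ℝ} (hf : ContinuousOn f D) (h0 : ∀ x, x ∉ K → f x = 0) :
    Integrable f := by
  have hsupp : Function.support f ⊆ K := fun x hx => by
    by_contra h
    exact hx (h0 x h)
  have hts : tsupport f ⊆ K := closure_minimal hsupp hK.isClosed
  exact (hf.continuous_of_tsupport_subset hD (hts.trans hKD)).integrable_of_hasCompactSupport
    (HasCompactSupport.of_support_subset_isCompact hK hsupp)

variable {D : Set Plane} {u ψ : Plane → Plane} {a : GradientForm}

lemma integrable_form_of_contDiffOn (hD : IsOpen D) (hu : ContDiffOn ℝ 2 u D)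
    (hψ : IsAdmissible D ψ) (a : GradientForm) :
    Integrable fun x => a (fderiv ℝ u x) (fderiv ℝ ψ x) := by
  have h1 : ContinuousOn (fderiv ℝ u) D := hu.continuousOn_fderiv_of_isOpen hD (by norm_num)
  have h2 := hψ.continuous_fderiv.continuousOn (s := D)
  refine integrable_of_continuousOn_of_eq_zero hD hψ.hasCompactSupport.isCompact
    hψ.tsupport_subset (by fun_prop) fun x hx => ?_
  rw [fderiv_eq_zero_of_notMem_tsupport hx, map_zero]

lemma integrable_inner_of_continuousOn (hD : IsOpen D) (hu : ContinuousOn u D)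
    (hψ : IsAdmissible D ψ) : Integrable fun x => (inner ℝ (u x) (ψ x) : ℝ) := by
  have h2 := hψ.contDiff.continuous.continuousOn (s := D)
  refine integrable_of_continuousOn_of_eq_zero hD hψ.hasCompactSupport.isCompact
    hψ.tsupport_subset (by fun_prop) fun x hx => ?_
  rw [image_eq_zero_of_notMem_tsupport hx, inner_zero_right]

/-- Green's formula for the gradient form `a`. -/
lemma integral_form_fderiv_eq (hD : IsOpen D) (hu : ContDiffOn ℝ 2 u D) (hψ : IsAdmissible D ψ)
    (a : GradientForm) : ∫ x, a (fderiv ℝ u x) (fderiv ℝ ψ x) =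
      -∫ x, ∑ j, a (fderiv ℝ (fderiv ℝ u) x (EuclideanSpace.single j 1)) (rankOne j (ψ x)) := by
  have hat : ∀ x ∈ D, ContDiffAt ℝ 2 u x := fun x hx => hu.contDiffAt (hD.mem_nhds hx)
  have hc1 : ContinuousOn (fderiv ℝ u) D := hu.continuousOn_fderiv_of_isOpen hD (by norm_num)
  have hcd : ContDiffOn ℝ 1 (fderiv ℝ u) D := hu.fderiv_of_isOpen hD (by norm_num)
  have hc2 : ContinuousOn (fderiv ℝ (fderiv ℝ u)) D :=
    hcd.continuousOn_fderiv_of_isOpen hD (by norm_num)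
  have hcψ : ContinuousOn ψ D := hψ.contDiff.continuous.continuousOn
  have hcψ' : ContinuousOn (fderiv ℝ ψ) D := hψ.continuous_fderiv.continuousOn
  have hint : ∀ f : Plane → ℝ, ContinuousOn f D → (∀ x, x ∉ tsupport ψ → f x = 0) → Integrable f :=
    fun f => integrable_of_continuousOn_of_eq_zero hD hψ.hasCompactSupport.isCompact
      hψ.tsupport_subset
  have hz : ∀ x, x ∉ tsupport ψ → ψ x = 0 := fun x hx => image_eq_zero_of_notMem_tsupport hx
  have hz' : ∀ x, x ∉ tsupport ψ → fderiv ℝ ψ x = 0 :=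
    fun x hx => fderiv_eq_zero_of_notMem_tsupport hx
  have hint1 : ∀ j : Fin 2, Integrable fun x =>
      a (fderiv ℝ u x) (rankOne j (fderiv ℝ ψ x (EuclideanSpace.single j 1))) := fun j => by
    refine hint _ ?_ fun x hx => by
      rw [hz' x hx, zero_apply, map_zero, map_zero]
    exact (a.continuous.comp_continuousOn hc1).clm_apply
      ((rankOne j).continuous.comp_continuousOn (hcψ'.clm_apply continuousOn_const))
  have hint2 : ∀ j : Fin 2, Integrable fun x =>
      a (fderiv ℝ (fderiv ℝ u) x (EuclideanSpace.single j 1)) (rankOne j (ψ x)) := fun j => by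
    refine hint _ ?_ fun x hx => by rw [hz x hx, map_zero, map_zero]
    exact (a.continuous.comp_continuousOn (hc2.clm_apply continuousOn_const)).clm_apply
      ((rankOne j).continuous.comp_continuousOn hcψ)
  have key : ∀ j : Fin 2,
      ∫ x, a (fderiv ℝ (fderiv ℝ u) x (EuclideanSpace.single j 1)) (rankOne j (ψ x)) =
      -∫ x, a (fderiv ℝ u x) (rankOne j (fderiv ℝ ψ x (EuclideanSpace.single j 1))) := fun j => by
    obtain ⟨B, hB⟩ : ∃ B : Plane →L[ℝ] (Plane →L[ℝ] Plane) →L[ℝ] ℝ,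
        ∀ p F, B p F = a F (rankOne j p) := ⟨a.flip.comp (rankOne j), fun _ _ => rfl⟩
    have h1 := hint1 j
    have h2 := hint2 j
    simp_rw [← hB] at h1 h2 ⊢
    -- Integration by parts over the whole plane: the derivative of `fderiv ℝ u` is needed only on
    -- the support of `ψ`, which lies inside `D`, so no boundary behaviour of `u` enters.
    refine integral_bilinear_hasLineDerivAt_right_eq_neg_left_of_integrable
      (v := EuclideanSpace.single j 1) h1 h2 ?_ ?_ ?_
    · refine hint _ ?_ fun x hx => by simp [hz x hx]
      fun_prop
    · intro x _
      exact (hψ.differentiable x).hasFDerivAt.hasLineDerivAt _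
    · intro x hx
      exact ((((hat x (hψ.tsupport_subset hx)).fderiv_right (m := 1) (by norm_num)).differentiableAt
        (by norm_num)).hasFDerivAt).hasLineDerivAt _
  have hsum : ∀ x, a (fderiv ℝ u x) (fderiv ℝ ψ x) =
      ∑ j, a (fderiv ℝ u x) (rankOne j (fderiv ℝ ψ x (EuclideanSpace.single j 1))) := fun x => by
    rw [← map_sum, sum_rankOne]
  simp_rw [hsum]
  rw [integral_finsetSum _ fun j _ => hint1 j, integral_finsetSum _ fun j _ => hint2 j,
    ← Finset.sum_neg_distrib]
  exact Finset.sum_congr rfl fun j _ => by rw [key j, neg_neg]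

/-- Weak form of the stationary Lamé equation, tested with fields compactly supported in `D`. -/
theorem integral_lameForm_eq_zero {lam mu rho t k : ℝ} (hD : IsOpen D) (hu : ContDiffOn ℝ 2 u D)
    (heq : ∀ x ∈ D, lameOperator lam mu rho u x = k • u x) (hψ : IsAdmissible D ψ) :
    ∫ x, (lameForm (shearVelocity mu rho ^ 2) (pressureVelocity lam mu rho ^ 2) t
      (fderiv ℝ u x) (fderiv ℝ ψ x) + k * inner ℝ (u x) (ψ x)) = 0 := by
  rw [integral_add (integrable_form_of_contDiffOn hD hu hψ _)
    ((integrable_inner_of_continuousOn hD hu.continuousOn hψ).const_mul k),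
    integral_form_fderiv_eq hD hu hψ, neg_add_eq_zero]
  refine integral_congr_ae (ae_of_all _ fun x => ?_)
  by_cases hx : x ∈ tsupport ψ
  · have hxD := hψ.tsupport_subset hx
    have h1 := sum_lameForm_rankOne lam mu rho t (hu.contDiffAt (hD.mem_nhds hxD)) (ψ x)
    rw [heq x hxD, inner_smul_left] at h1
    exact h1
  · simp [image_eq_zero_of_notMem_tsupport hx]

end WeakEquation

/-! ### Volume, Poincaré and gradient estimates with a common constant -/

section StripEstimates

variable {D : Set Plane} {a : GradientForm} {m N k : ℝ}

/-- Estimates in the strip of width `s` along the boundary, uniform as `s → 0`. -/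
theorem exists_strip_estimates (hD : IsOpen D) (hK : Bornology.IsBounded Dᶜ) (hne : Dᶜ.Nonempty)
    (hcone : ∀ y ∈ frontier Dᶜ, ∃ (e : Plane) (r : ℝ), 0 < r ∧ HasOutwardCone Dᶜ y e r)
    (ha : IsElliptic a m N) (hk : 0 ≤ k) {d : ℝ} (hd : 0 < d) :
    ∃ C, 1 ≤ C ∧ ∃ s₀ > 0, ∀ s ∈ Ioc 0 s₀,
      volume.real (strip D s) ≤ C * s ∧
      (∀ v, IsAdmissible D v → ∫ x in strip D s, ‖v x‖ ^ 2 ≤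
        C * s ^ 2 * ∫ x in strip D (C * s), ‖fderiv ℝ v x‖ ^ 2) ∧
      ∀ g v ε, Continuous g → (∀ x, g x ≠ 0 → d ≤ infDist x Dᶜ) → 0 ≤ ε →
        IsNearMinimizer a k D g ε v →
        ∫ x in strip D s, ‖fderiv ℝ v x‖ ^ 2 ≤ C * (s * energy a k v v + ε) := by
  have hKc : IsCompact Dᶜ := Metric.isCompact_of_isClosed_isBounded hD.isClosed_compl hK
  obtain ⟨ξ, hξ, hξc, hξd, c, hc, h₀, hh₀, hpush⟩ := exists_transversal_field hKc hne hcone hd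
  obtain ⟨L, hL⟩ := hξ.lipschitzWith_of_hasCompactSupport hξc (by norm_num)
  obtain ⟨M, hM⟩ := hξ.continuous.bounded_above_of_compact_support hξc
  have hM0 : 0 ≤ M := (norm_nonneg _).trans (hM 0)
  have hm := ha.pos
  have hN := ha.nonneg
  set V := volume.real Dᶜ with hV
  have hV0 : 0 ≤ V := measureReal_nonneg
  set C₁ := 8 * L / c * V with hC₁
  set C₂ := 2 * (M / c) ^ 2 with hC₂
  set C₃ := M / c with hC₃
  set C₄ := 2 * ((6 * N * L / m + 8 * L) / c) / m with hC₄
  set C₅ := 8 / m with hC₅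
  have hC₁0 : 0 ≤ C₁ := by positivity
  have hC₂0 : 0 ≤ C₂ := by positivity
  have hC₃0 : 0 ≤ C₃ := by positivity
  have hC₄0 : 0 ≤ C₄ := by positivity
  have hC₅0 : 0 ≤ C₅ := by positivity
  -- One constant dominates all the others. In particular `1 + C₃ ≤ C` covers the wider strip, of
  -- width `s + hM = (1 + C₃)s`, that the segments of length at most `hM` can reach.
  set C := C₁ + C₂ + C₃ + C₄ + C₅ + 1 with hC
  refine ⟨C, by linarith, c * min h₀ (1 / (8 * L + 1)), by positivity, ?_⟩
  rintro s ⟨hs0, hs⟩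
  obtain ⟨h, rfl⟩ : ∃ h, s = c * h := ⟨s / c, by field_simp⟩
  have hh : 0 < h := pos_of_mul_pos_right hs0 hc.le
  have hle := le_of_mul_le_mul_left hs hc
  have hhL : 8 * (h * L) ≤ 1 := by
    have := (le_div_iff₀ (by positivity)).1 (hle.trans (min_le_right _ _))
    linarith
  have hp : ∀ x, infDist x Dᶜ ≤ c * h → x - h • ξ x ∈ Dᶜ :=
    hpush h ⟨hh, hle.trans (min_le_left _ _)⟩
  refine ⟨?_, fun v hv => ?_, fun g v ε hg hgd hε hv => ?_⟩
  · have h1 := volume_strip_le hD hK hξ hL hh.le hs0.le hhL hp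
    have h2 : volume.real (strip D (c * h)) ≤ 8 * L * h * V := by
      rw [Measure.real, hV, Measure.real, ← ENNReal.toReal_ofReal (r := 8 * L * h) (by positivity),
        ← ENNReal.toReal_mul]
      exact ENNReal.toReal_mono (ENNReal.mul_ne_top ENNReal.ofReal_ne_top hK.measure_lt_top.ne) h1
    calc _ ≤ 8 * L * h * V := h2
      _ = C₁ * (c * h) := by rw [hC₁]; field_simp
      _ ≤ C * (c * h) := by gcongr; linarith
  · refine (integral_strip_le hD hξ hL hM hh.le hhL hp hv.contDiff hv.hasCompactSupport
      hv.tsupport_subset).trans ?_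
    have h1 : 2 * (h * M) ^ 2 = C₂ * (c * h) ^ 2 := by rw [hC₂, hC₃]; field_simp
    have h2 : c * h + h * M = (1 + C₃) * (c * h) := by rw [hC₃]; field_simp
    rw [h1, h2]
    have h3 : C₂ ≤ C := by linarith
    have h4 : 1 + C₃ ≤ C := by linarith
    refine mul_le_mul (by gcongr) ?_ (integral_nonneg fun _ => sq_nonneg _) (by positivity)
    refine setIntegral_mono_set hv.integrable_norm_fderiv_sq.integrableOn
      (ae_of_all _ fun _ => sq_nonneg _) (LE.le.eventuallyLE (strip_mono ?_))
    gcongr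
  · have hgξ : ∀ x, g x ≠ 0 → ξ x = 0 := fun x hx => by
      by_contra hne
      exact absurd (hξd x hne) (not_lt.2 (hgd x hx))
    have h1 := hv.integral_strip_le ha hk hD hg hξ hξc hgξ hL hh.le hs0.le hhL hp
    have hE := energy_self_nonneg ha hk hv.isAdmissible
    have h2 : ∫ x in strip D (c * h), ‖fderiv ℝ v x‖ ^ 2 ≤
        C₄ * (c * h * energy a k v v) + C₅ * ε := by
      rw [← le_div_iff₀' hm] at h1
      refine h1.trans (le_of_eq ?_)
      rw [hC₄, hC₅]
      field_simp
    have h3 : 0 ≤ c * h * energy a k v v := by positivity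
    have h4 : C₄ * (c * h * energy a k v v) ≤ C * (c * h * energy a k v v) := by
      gcongr; linarith
    have h5 : C₅ * ε ≤ C * ε := by gcongr; linarith
    linarith

end StripEstimates

/-! ### Localization: Caccioppoli inequality and the pairing identity -/

section Localization

variable {D : Set Plane} {u v W : Plane → Plane} {φ : Plane → ℝ} {a : GradientForm} {m N k : ℝ}

/-- Cutoff functions of class `C¹` with compact support in `D`. -/
structure IsCutoff (D : Set Plane) (φ : Plane → ℝ) : Prop where
  contDiff : ContDiff ℝ 1 φ
  hasCompactSupport : HasCompactSupport φ
  tsupport_subset : tsupport φ ⊆ D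
  nonneg : ∀ x, 0 ≤ φ x
  le_one : ∀ x, φ x ≤ 1

namespace IsCutoff

lemma differentiable (hφ : IsCutoff D φ) : Differentiable ℝ φ := hφ.contDiff.differentiable (by norm_num)

lemma continuous_fderiv (hφ : IsCutoff D φ) : Continuous (fderiv ℝ φ) :=
  hφ.contDiff.continuous_fderiv (by norm_num)

lemma eq_zero (_hφ : IsCutoff D φ) {x : Plane} (hx : x ∉ tsupport φ) : φ x = 0 :=
  image_eq_zero_of_notMem_tsupport hx

lemma fderiv_eq_zero (_hφ : IsCutoff D φ) {x : Plane} (hx : x ∉ tsupport φ) : fderiv ℝ φ x = 0 := by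
  rw [(notMem_tsupport_iff_eventuallyEq.1 hx).fderiv_eq]
  simp

lemma integrable (hφ : IsCutoff D φ) (hD : IsOpen D) {f : Plane → ℝ} (hf : ContinuousOn f D)
    (h0 : ∀ x, x ∉ tsupport φ → f x = 0) : Integrable f :=
  integrable_of_continuousOn_of_eq_zero hD hφ.hasCompactSupport.isCompact hφ.tsupport_subset hf h0

lemma isAdmissible_sq_smul (hφ : IsCutoff D φ) (hD : IsOpen D) (hu : ContDiffOn ℝ 1 u D) :
    IsAdmissible D fun x => φ x ^ 2 • u x := by
  have hsupp : Function.support (fun x => φ x ^ 2 • u x) ⊆ Function.support φ := fun x hx => by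
    simp only [Function.mem_support] at *
    exact fun h => hx (by simp [h])
  refine ⟨contDiff_iff_contDiffAt.2 fun x => ?_, hφ.hasCompactSupport.mono hsupp,
    (closure_mono hsupp).trans hφ.tsupport_subset⟩
  by_cases hx : x ∈ D
  · exact (hφ.contDiff.contDiffAt.pow 2).smul (hu.contDiffAt (hD.mem_nhds hx))
  · have hx' : x ∉ tsupport φ := fun h => hx (hφ.tsupport_subset h)
    refine (contDiffAt_const (c := (0 : Plane))).congr_of_eventuallyEq ?_
    filter_upwards [notMem_tsupport_iff_eventuallyEq.1 hx'] with y hy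
    simp [hy]

lemma fderiv_sq_smul (hφ : IsCutoff D φ) (hD : IsOpen D) (hu : ContDiffOn ℝ 1 u D) {x : Plane}
    (hx : x ∈ D) : fderiv ℝ (fun x => φ x ^ 2 • u x) x =
      φ x ^ 2 • fderiv ℝ u x + (2 * φ x) • (fderiv ℝ φ x).smulRight (u x) := by
  have h1 : HasFDerivAt u (fderiv ℝ u x) x :=
    ((hu.contDiffAt (hD.mem_nhds hx)).differentiableAt (by norm_num)).hasFDerivAt
  have h2 := ((hφ.differentiable x).hasFDerivAt.pow 2).smul h1
  have h3 : fderiv ℝ (fun x => φ x ^ 2 • u x) x = _ := h2.fderiv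
  rw [h3]
  ext y i
  simp
  ring

/-- Caccioppoli inequality. -/
lemma caccioppoli (hφ : IsCutoff D φ) (hD : IsOpen D) (ha : IsElliptic a m N)
    (hW : ContDiffOn ℝ 1 W D)
    (hweak : ∀ ψ, IsAdmissible D ψ →
      ∫ x, (a (fderiv ℝ W x) (fderiv ℝ ψ x) + k * inner ℝ (W x) (ψ x)) = 0) :
    m / 2 * (∫ x, φ x ^ 2 * ‖fderiv ℝ W x‖ ^ 2) + k * ∫ x, φ x ^ 2 * ‖W x‖ ^ 2 ≤
      2 * N ^ 2 / m * ∫ x, ‖fderiv ℝ φ x‖ ^ 2 * ‖W x‖ ^ 2 := by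
  have hm := ha.pos
  have hN := ha.nonneg
  have hψ := hφ.isAdmissible_sq_smul hD hW
  have hcW := hW.continuousOn
  have hcW' : ContinuousOn (fderiv ℝ W) D := hW.continuousOn_fderiv_of_isOpen hD (by norm_num)
  have hcφ := hφ.contDiff.continuous.continuousOn (s := D)
  have hcφ' := hφ.continuous_fderiv.continuousOn (s := D)
  have i1 : Integrable fun x => φ x ^ 2 * ‖fderiv ℝ W x‖ ^ 2 :=
    hφ.integrable hD (by fun_prop) fun x hx => by simp [hφ.eq_zero hx]
  have i2 : Integrable fun x => φ x ^ 2 * ‖W x‖ ^ 2 :=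
    hφ.integrable hD (by fun_prop) fun x hx => by simp [hφ.eq_zero hx]
  have i3 : Integrable fun x => ‖fderiv ℝ φ x‖ ^ 2 * ‖W x‖ ^ 2 :=
    hφ.integrable hD (by fun_prop) fun x hx => by simp [hφ.fderiv_eq_zero hx]
  have i12 : Integrable fun x => m / 2 * (φ x ^ 2 * ‖fderiv ℝ W x‖ ^ 2) +
    k * (φ x ^ 2 * ‖W x‖ ^ 2) := (i1.const_mul _).add (i2.const_mul _)
  have h0 := hweak _ hψ
  rw [← sub_nonpos, ← integral_const_mul, ← integral_const_mul, ← integral_const_mul,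
    ← integral_add (i1.const_mul _) (i2.const_mul _),
    ← integral_sub i12 (i3.const_mul _), ← h0]
  refine integral_mono (i12.sub (i3.const_mul _)) ?_ fun x => ?_
  · have hcψ := hψ.contDiff.continuous.continuousOn (s := D)
    have hcψ' := hψ.continuous_fderiv.continuousOn (s := D)
    refine integrable_of_continuousOn_of_eq_zero hD hψ.hasCompactSupport.isCompact
      hψ.tsupport_subset (by fun_prop) fun x hx => ?_
    rw [fderiv_eq_zero_of_notMem_tsupport hx, map_zero, image_eq_zero_of_notMem_tsupport hx,
      inner_zero_right, mul_zero, add_zero]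
  · by_cases hx : x ∈ D
    · simp only [hφ.fderiv_sq_smul hD hW hx, map_add, map_smul, smul_eq_mul, inner_smul_right,
        real_inner_self_eq_norm_sq]
      have h1 := mul_le_mul_of_nonneg_left (ha.coercive (fderiv ℝ W x)) (sq_nonneg (φ x))
      have h2 := (abs_le.1 (ha.bound (fderiv ℝ W x) ((fderiv ℝ φ x).smulRight (W x)))).1
      rw [ContinuousLinearMap.norm_smulRight_apply] at h2
      have h3 := mul_le_mul_of_nonneg_left h2 (hφ.nonneg x)
      -- Young's inequality as a completed square: the cross term from `∇(φ²W)` uses up half of the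
      -- coercive term, leaving `m / 2`.
      have h4 : 0 ≤ m / 2 * (φ x * ‖fderiv ℝ W x‖ - 2 * N / m * (‖fderiv ℝ φ x‖ * ‖W x‖)) ^ 2 := by
        positivity
      have h5 : m / 2 * (φ x * ‖fderiv ℝ W x‖ - 2 * N / m * (‖fderiv ℝ φ x‖ * ‖W x‖)) ^ 2 =
          m / 2 * (φ x ^ 2 * ‖fderiv ℝ W x‖ ^ 2) -
          2 * (φ x * (N * ‖fderiv ℝ W x‖ * (‖fderiv ℝ φ x‖ * ‖W x‖))) +
          2 * N ^ 2 / m * (‖fderiv ℝ φ x‖ ^ 2 * ‖W x‖ ^ 2) := by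
        field_simp
        ring
      linarith
    · have hx' : x ∉ tsupport φ := fun h => hx (hφ.tsupport_subset h)
      simp [hφ.eq_zero hx', hφ.fderiv_eq_zero hx', hψ.fderiv_eq_zero hx]

/-- Only finiteness matters here. The right-hand side may blow up as the strip shrinks, but it gets
multiplied by the minimization error `ε`, which is chosen afterwards. -/
lemma energy_sq_smul_le (hφ : IsCutoff D φ) (hD : IsOpen D) (ha : IsElliptic a m N) (hk : 0 ≤ k)
    (hW : ContDiffOn ℝ 1 W D) :
    energy a k (fun x => φ x ^ 2 • W x) (fun x => φ x ^ 2 • W x) ≤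
      2 * N * (∫ x, φ x ^ 2 * ‖fderiv ℝ W x‖ ^ 2) + k * (∫ x, φ x ^ 2 * ‖W x‖ ^ 2) +
      8 * N * ∫ x, ‖fderiv ℝ φ x‖ ^ 2 * ‖W x‖ ^ 2 := by
  have hN := ha.nonneg
  have hψ := hφ.isAdmissible_sq_smul hD hW
  have hcW := hW.continuousOn
  have hcW' : ContinuousOn (fderiv ℝ W) D := hW.continuousOn_fderiv_of_isOpen hD (by norm_num)
  have hcφ := hφ.contDiff.continuous.continuousOn (s := D)
  have hcφ' := hφ.continuous_fderiv.continuousOn (s := D)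
  have i1 : Integrable fun x => φ x ^ 2 * ‖fderiv ℝ W x‖ ^ 2 :=
    hφ.integrable hD (by fun_prop) fun x hx => by simp [hφ.eq_zero hx]
  have i2 : Integrable fun x => φ x ^ 2 * ‖W x‖ ^ 2 :=
    hφ.integrable hD (by fun_prop) fun x hx => by simp [hφ.eq_zero hx]
  have i3 : Integrable fun x => ‖fderiv ℝ φ x‖ ^ 2 * ‖W x‖ ^ 2 :=
    hφ.integrable hD (by fun_prop) fun x hx => by simp [hφ.fderiv_eq_zero hx]
  have i12 : Integrable fun x => 2 * N * (φ x ^ 2 * ‖fderiv ℝ W x‖ ^ 2) +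
    k * (φ x ^ 2 * ‖W x‖ ^ 2) := (i1.const_mul _).add (i2.const_mul _)
  rw [← integral_const_mul, ← integral_const_mul, ← integral_const_mul,
    ← integral_add (i1.const_mul _) (i2.const_mul _), ← integral_add i12 (i3.const_mul _)]
  refine integral_mono (hψ.integrable_energy hψ a k) (i12.add (i3.const_mul _)) fun x => ?_
  have hφ0 := hφ.nonneg x
  have hφ1 := hφ.le_one x
  have hφ2 : φ x ^ 2 ≤ φ x := by nlinarith
  by_cases hx : x ∈ D
  · have h1 := (le_abs_self _).trans (ha.bound (fderiv ℝ (fun x => φ x ^ 2 • W x) x)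
      (fderiv ℝ (fun x => φ x ^ 2 • W x) x))
    have h2 : ‖fderiv ℝ (fun x => φ x ^ 2 • W x) x‖ ≤
        φ x * ‖fderiv ℝ W x‖ + 2 * (‖fderiv ℝ φ x‖ * ‖W x‖) := by
      rw [hφ.fderiv_sq_smul hD hW hx]
      refine (norm_add_le _ _).trans ?_
      rw [norm_smul, norm_smul, ContinuousLinearMap.norm_smulRight_apply,
        Real.norm_of_nonneg (by positivity), Real.norm_of_nonneg (by positivity)]
      gcongr
      linarith
    set A := φ x * ‖fderiv ℝ W x‖ with hA
    set B := ‖fderiv ℝ φ x‖ * ‖W x‖ with hB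
    have h3 : ‖fderiv ℝ (fun x => φ x ^ 2 • W x) x‖ ^ 2 ≤ 2 * A ^ 2 + 8 * B ^ 2 := by
      calc _ ≤ (A + 2 * B) ^ 2 := by gcongr
        _ ≤ _ := by nlinarith [sq_nonneg (A - 2 * B)]
    have h4 : ‖φ x ^ 2 • W x‖ ^ 2 ≤ φ x ^ 2 * ‖W x‖ ^ 2 := by
      rw [norm_smul, Real.norm_of_nonneg (by positivity), mul_pow]
      gcongr
    have h5 : k * inner ℝ (φ x ^ 2 • W x) (φ x ^ 2 • W x) ≤ k * (φ x ^ 2 * ‖W x‖ ^ 2) := by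
      rw [real_inner_self_eq_norm_sq]
      gcongr
    have h6 := mul_le_mul_of_nonneg_left h3 hN
    have h7 : A ^ 2 = φ x ^ 2 * ‖fderiv ℝ W x‖ ^ 2 := mul_pow _ _ _
    have h8 : B ^ 2 = ‖fderiv ℝ φ x‖ ^ 2 * ‖W x‖ ^ 2 := mul_pow _ _ _
    rw [h7, h8] at h6
    simp only []
    linarith
  · have hx' : x ∉ tsupport φ := fun h => hx (hφ.tsupport_subset h)
    simp [hφ.eq_zero hx', hφ.fderiv_eq_zero hx', hψ.fderiv_eq_zero hx]

/-- Pairing a test field with a localized solution leaves only terms where the cutoff varies. -/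
lemma energy_pairing (hφ : IsCutoff D φ) (hD : IsOpen D) (ha : IsElliptic a m N)
    (hW : ContDiffOn ℝ 1 W D) (hv : IsAdmissible D v)
    (hweak : ∀ ψ, IsAdmissible D ψ →
      ∫ x, (a (fderiv ℝ W x) (fderiv ℝ ψ x) + k * inner ℝ (W x) (ψ x)) = 0) :
    energy a k v (fun x => φ x ^ 2 • W x) =
      ∫ x, (2 * φ x * a (fderiv ℝ v x) ((fderiv ℝ φ x).smulRight (W x)) -
        2 * φ x * a (fderiv ℝ W x) ((fderiv ℝ φ x).smulRight (v x))) := by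
  have hψ := hφ.isAdmissible_sq_smul hD hW
  -- The weak equation of `W` is tested with `φ² v`. Subtracting it from the energy cancels, by
  -- symmetry of `a`, every term in which `φ` is not differentiated.
  have hψ' := hφ.isAdmissible_sq_smul hD hv.contDiff.contDiffOn
  have h0 := hweak _ hψ'
  have hcW := hW.continuousOn
  have hcW' : ContinuousOn (fderiv ℝ W) D := hW.continuousOn_fderiv_of_isOpen hD (by norm_num)
  have hcψ := hψ'.contDiff.continuous.continuousOn (s := D)
  have hcψ' := hψ'.continuous_fderiv.continuousOn (s := D)
  have hi : Integrable fun x => a (fderiv ℝ W x) (fderiv ℝ (fun x => φ x ^ 2 • v x) x) +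
      k * inner ℝ (W x) (φ x ^ 2 • v x) :=
    integrable_of_continuousOn_of_eq_zero hD hψ'.hasCompactSupport.isCompact
      hψ'.tsupport_subset (by fun_prop) fun x hx => by
      rw [fderiv_eq_zero_of_notMem_tsupport hx, map_zero,
        image_eq_zero_of_notMem_tsupport (f := fun x => φ x ^ 2 • v x) hx,
        inner_zero_right, mul_zero, add_zero]
  rw [← sub_zero (energy a k v _), ← h0, energy, ← integral_sub (hv.integrable_energy hψ a k) hi]
  refine integral_congr_ae (ae_of_all _ fun x => ?_)
  by_cases hx : x ∈ D
  · simp only [hφ.fderiv_sq_smul hD hW hx, hφ.fderiv_sq_smul hD hv.contDiff.contDiffOn hx, map_add,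
      map_smul, smul_eq_mul, inner_smul_right, ha.symm (fderiv ℝ W x) (fderiv ℝ v x),
      real_inner_comm (v x) (W x)]
    ring
  · have hx' : x ∉ tsupport φ := fun h => hx (hφ.tsupport_subset h)
    simp [hφ.eq_zero hx', hψ'.fderiv_eq_zero hx, hv.fderiv_eq_zero hx, hv.eq_zero hx]

/-- Young's inequality is used unweighted, as `2p ≤ p² + 1`, on the term with `∇v` and `W`, and with
weight `τ` on the term with `∇W` and `v`. The conditions on `∇φ` concern only the support of `v`, so
the outer part of the cutoff plays no role. -/
lemma abs_energy_pairing_le (hφ : IsCutoff D φ) (hD : IsOpen D) (ha : IsElliptic a m N)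
    (hW : ContDiffOn ℝ 1 W D) (hv : IsAdmissible D v)
    (hweak : ∀ ψ, IsAdmissible D ψ →
      ∫ x, (a (fderiv ℝ W x) (fderiv ℝ ψ x) + k * inner ℝ (W x) (ψ x)) = 0)
    {s ω τ : ℝ} (hs : 0 < s) (hτ : 0 < τ) (hvol : volume (strip D s) ≠ ⊤)
    (hWω : ∀ x ∈ strip D s, ‖W x‖ ≤ ω)
    (hφs : ∀ x ∈ tsupport v, ‖fderiv ℝ φ x‖ ≤ 4 / s)
    (hφ0 : ∀ x ∈ tsupport v, x ∉ strip D s → fderiv ℝ φ x = 0) :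
    |energy a k v (fun x => φ x ^ 2 • W x)| ≤
      4 * N / s * (ω * ((∫ x in strip D s, ‖fderiv ℝ v x‖ ^ 2) + volume.real (strip D s)) +
        (τ * (∫ x, φ x ^ 2 * ‖fderiv ℝ W x‖ ^ 2) + τ⁻¹ * ∫ x in strip D s, ‖v x‖ ^ 2)) := by
  have hN := ha.nonneg
  have hms := measurableSet_strip hD s
  have hcW' : ContinuousOn (fderiv ℝ W) D := hW.continuousOn_fderiv_of_isOpen hD (by norm_num)
  have hcφ := hφ.contDiff.continuous.continuousOn (s := D)
  have j1 : Integrable ((strip D s).indicator fun x => ‖fderiv ℝ v x‖ ^ 2) :=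
    hv.integrable_norm_fderiv_sq.indicator hms
  have j2 : Integrable ((strip D s).indicator fun _ => (1 : ℝ)) :=
    (integrable_indicator_iff hms).2 (integrableOn_const hvol)
  have j3 : Integrable fun x => φ x ^ 2 * ‖fderiv ℝ W x‖ ^ 2 :=
    hφ.integrable hD (by fun_prop) fun x hx => by simp [hφ.eq_zero hx]
  have j4 : Integrable ((strip D s).indicator fun x => ‖v x‖ ^ 2) :=
    hv.integrable_norm_sq.indicator hms
  have e2 : volume.real (strip D s) = ∫ x, (strip D s).indicator (fun _ => (1 : ℝ)) x := by
    rw [integral_indicator hms]; simp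
  have j12 : Integrable fun x => ω * ((strip D s).indicator (fun x => ‖fderiv ℝ v x‖ ^ 2) x +
    (strip D s).indicator (fun _ => (1 : ℝ)) x) := (j1.add j2).const_mul _
  have j34 : Integrable fun x => τ * (φ x ^ 2 * ‖fderiv ℝ W x‖ ^ 2) +
    τ⁻¹ * (strip D s).indicator (fun x => ‖v x‖ ^ 2) x := (j3.const_mul _).add (j4.const_mul _)
  rw [← integral_indicator hms, ← integral_indicator hms, e2, ← integral_add j1 j2,
    ← integral_const_mul ω, ← integral_const_mul τ, ← integral_const_mul τ⁻¹,
    ← integral_add (j3.const_mul _) (j4.const_mul _),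
    ← integral_add j12 j34,
    ← integral_const_mul, hφ.energy_pairing hD ha hW hv hweak, ← Real.norm_eq_abs]
  refine norm_integral_le_of_norm_le ((j12.add j34).const_mul _) (ae_of_all _ fun x => ?_)
  rw [Real.norm_eq_abs]
  have hφx := hφ.nonneg x
  have hφx1 := hφ.le_one x
  by_cases hx : x ∈ strip D s
  · simp only [indicator_of_mem hx]
    by_cases hxv : x ∈ tsupport v
    · have hω : 0 ≤ ω := (norm_nonneg _).trans (hWω x hx)
      have h1 := ha.bound (fderiv ℝ v x) ((fderiv ℝ φ x).smulRight (W x))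
      have h2 := ha.bound (fderiv ℝ W x) ((fderiv ℝ φ x).smulRight (v x))
      rw [ContinuousLinearMap.norm_smulRight_apply] at h1 h2
      have h3 := hφs x hxv
      have h4 := hWω x hx
      set p := ‖fderiv ℝ v x‖
      set q := ‖fderiv ℝ W x‖
      have hp : 0 ≤ p := norm_nonneg _
      have hq : 0 ≤ q := norm_nonneg _
      have h5 : |2 * φ x * a (fderiv ℝ v x) ((fderiv ℝ φ x).smulRight (W x))| ≤
          2 * 1 * (N * p * (4 / s * ω)) := by
        rw [abs_mul, abs_of_nonneg (by positivity)]
        gcongr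
        exact h1.trans (by gcongr)
      have h6 : |2 * φ x * a (fderiv ℝ W x) ((fderiv ℝ φ x).smulRight (v x))| ≤
          2 * φ x * (N * q * (4 / s * ‖v x‖)) := by
        rw [abs_mul, abs_of_nonneg (by positivity)]
        gcongr
        exact h2.trans (by gcongr)
      have h7 : 2 * p ≤ p ^ 2 + 1 := by nlinarith [sq_nonneg (p - 1)]
      have h8 : 2 * (φ x * q * ‖v x‖) ≤ τ * (φ x ^ 2 * q ^ 2) + τ⁻¹ * ‖v x‖ ^ 2 := by
        have : 0 ≤ τ⁻¹ * (τ * (φ x * q) - ‖v x‖) ^ 2 := by positivity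
        have h9 : τ⁻¹ * (τ * (φ x * q) - ‖v x‖) ^ 2 =
            τ * (φ x ^ 2 * q ^ 2) + τ⁻¹ * ‖v x‖ ^ 2 - 2 * (φ x * q * ‖v x‖) := by
          field_simp
          ring
        linarith
      refine (abs_sub _ _).trans ((add_le_add h5 h6).trans ?_)
      calc 2 * 1 * (N * p * (4 / s * ω)) + 2 * φ x * (N * q * (4 / s * ‖v x‖))
          = 4 * N / s * (ω * (2 * p) + 2 * (φ x * q * ‖v x‖)) := by ring
        _ ≤ _ := by gcongr
    · rw [fderiv_eq_zero_of_notMem_tsupport hxv, image_eq_zero_of_notMem_tsupport hxv]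
      have hω : 0 ≤ ω := (norm_nonneg _).trans (hWω x hx)
      simp only [map_zero, zero_apply, ContinuousLinearMap.smulRight_zero, mul_zero, sub_zero,
        abs_zero]
      positivity
  · simp only [indicator_of_notMem hx]
    have h0 : 2 * φ x * a (fderiv ℝ v x) ((fderiv ℝ φ x).smulRight (W x)) -
        2 * φ x * a (fderiv ℝ W x) ((fderiv ℝ φ x).smulRight (v x)) = 0 := by
      by_cases hxv : x ∈ tsupport v
      · have : ∀ w : Plane, (0 : Plane →L[ℝ] ℝ).smulRight w = 0 := fun w => by ext; simp
        rw [hφ0 x hxv hx, this, this, map_zero, map_zero]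
        ring
      · rw [fderiv_eq_zero_of_notMem_tsupport hxv, image_eq_zero_of_notMem_tsupport hxv]
        simp
    rw [h0, abs_zero, add_zero, mul_zero, mul_zero, zero_add, add_zero]
    positivity

end IsCutoff

end Localization

/-! ### Vanishing of bounded weak solutions -/

section Uniqueness

variable {D : Set Plane} {W : Plane → Plane} {a : GradientForm} {m N k : ℝ}

lemma fderiv_eq_zero_of_eventuallyEq_const {f : Plane → ℝ} {x : Plane} {c : ℝ}
    (h : ∀ᶠ y in 𝓝 x, f y = c) : fderiv ℝ f x = 0 := by
  have h' : f =ᶠ[𝓝 x] fun _ => c := h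
  rw [h'.fderiv_eq]
  simp

/-- A cutoff to the points of `D` at distance at least `s` from the boundary and at most `R` from
the origin. -/
lemma exists_isCutoff (D : Set Plane) {s R : ℝ} (hs : 0 < s) (hR : 2 ≤ R) :
    ∃ φ, IsCutoff D φ ∧ (∀ x, s ≤ infDist x Dᶜ → ‖x‖ < R - 1 → φ x = 1) ∧
      (∀ x, ‖x‖ < R - 1 → ‖fderiv ℝ φ x‖ ≤ 4 / s) ∧
      (∀ x, ‖x‖ < R - 1 → x ∉ strip D s → fderiv ℝ φ x = 0) ∧
      ∀ x, ‖fderiv ℝ φ x‖ ≤ (strip D s).indicator (fun _ => 4 / s) x +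
        (closedBall (0 : Plane) (3 * R)).indicator (fun _ => 1 / R) x := by
  obtain ⟨η, h1, h2, h3, h4, h5, h6⟩ := exists_cutoff_infDist Dᶜ hs
  obtain ⟨χ, k1, k2, k3, k4, k5, k6⟩ := exists_cutoff_ball (E := Plane) hR
  have hcd := continuous_infDist_pt Dᶜ
  have hη : ∀ x, x ∉ strip D s → fderiv ℝ η x = 0 := fun x hx => by
    by_cases hxD : x ∈ D
    · have hlt : s * (7 / 8) < infDist x Dᶜ := by
        have : s < infDist x Dᶜ := not_le.1 fun h => hx ⟨hxD, h⟩
        linarith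
      exact fderiv_eq_zero_of_eventuallyEq_const
        ((hcd.continuousAt.eventually (lt_mem_nhds hlt)).mono fun y hy => h5 y (le_of_lt hy))
    · have hlt : infDist x Dᶜ < s / 8 := by
        rw [infDist_zero_of_mem (show x ∈ Dᶜ from hxD)]; positivity
      exact fderiv_eq_zero_of_eventuallyEq_const
        ((hcd.continuousAt.eventually (gt_mem_nhds hlt)).mono fun y hy => h4 y (le_of_lt hy))
  have hη' : ∀ x, ‖fderiv ℝ η x‖ ≤ (strip D s).indicator (fun _ => 4 / s) x := fun x => by
    by_cases hx : x ∈ strip D s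
    · rw [indicator_of_mem hx]; exact h6 x
    · rw [indicator_of_notMem hx, hη x hx, norm_zero]
  have hχ : ∀ x, ‖x‖ < R - 1 → fderiv ℝ χ x = 0 := fun x hx =>
    fderiv_eq_zero_of_eventuallyEq_const
      ((continuous_norm.continuousAt.eventually (gt_mem_nhds hx)).mono fun y hy => k4 y (le_of_lt hy))
  have hχ' : ∀ x, ‖fderiv ℝ χ x‖ ≤ (closedBall (0 : Plane) (3 * R)).indicator (fun _ => 1 / R) x :=
    fun x => by
    by_cases hx : x ∈ closedBall (0 : Plane) (3 * R)
    · rw [indicator_of_mem hx]; exact k6 x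
    · have hlt : 3 * R < ‖x‖ := by simpa using hx
      rw [indicator_of_notMem hx, fderiv_eq_zero_of_eventuallyEq_const
        ((continuous_norm.continuousAt.eventually (lt_mem_nhds hlt)).mono
          fun y hy => k5 y (le_of_lt hy)), norm_zero]
  have hd : ∀ x, fderiv ℝ (fun x => η x * χ x) x = η x • fderiv ℝ χ x + χ x • fderiv ℝ η x := fun x =>
    ((h1.differentiable (by norm_num) x).hasFDerivAt.mul
      (k1.differentiable (by norm_num) x).hasFDerivAt).fderiv
  have hnorm : ∀ x, ‖fderiv ℝ (fun x => η x * χ x) x‖ ≤ ‖fderiv ℝ χ x‖ + ‖fderiv ℝ η x‖ := fun x => by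
    rw [hd]
    refine (norm_add_le _ _).trans ?_
    rw [norm_smul, norm_smul, Real.norm_of_nonneg (h2 x), Real.norm_of_nonneg (k2 x)]
    exact add_le_add (mul_le_of_le_one_left (norm_nonneg _) (h3 x))
      (mul_le_of_le_one_left (norm_nonneg _) (k3 x))
  have hsupp : Function.support (fun x => η x * χ x) ⊆
      {x | s / 8 ≤ infDist x Dᶜ} ∩ closedBall 0 (3 * R) := fun x hx => by
    rw [Function.mem_support] at hx
    refine ⟨?_, ?_⟩
    · by_contra h
      exact hx (by rw [h4 x (not_le.1 h).le, zero_mul])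
    · by_contra h
      exact hx (by rw [k5 x (by simpa using (not_le.1 (mt mem_closedBall.2 h)).le), mul_zero])
  have hts : tsupport (fun x => η x * χ x) ⊆ {x | s / 8 ≤ infDist x Dᶜ} ∩ closedBall 0 (3 * R) :=
    closure_minimal hsupp ((isClosed_le continuous_const hcd).inter isClosed_closedBall)
  refine ⟨fun x => η x * χ x, ⟨h1.mul k1, ?_, fun x hx => ?_, fun x => mul_nonneg (h2 x) (k2 x),
    fun x => mul_le_one₀ (h3 x) (k2 x) (k3 x)⟩, fun x hx hxR => ?_, fun x hxR => ?_,
    fun x hxR hx => ?_, fun x => ?_⟩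
  · exact HasCompactSupport.of_support_subset_isCompact (isCompact_closedBall _ _)
      (hsupp.trans inter_subset_right)
  · by_contra hxD
    have h7 : s / 8 ≤ infDist x Dᶜ := (hts hx).1
    rw [infDist_zero_of_mem (show x ∈ Dᶜ from hxD)] at h7
    linarith
  · simp only [h5 x (by linarith), k4 x hxR.le, mul_one]
  · refine (hnorm x).trans ?_
    rw [hχ x hxR, norm_zero, zero_add]
    exact h6 x
  · rw [hd, hχ x hxR, hη x hx, smul_zero, smul_zero, add_zero]
  · refine (hnorm x).trans ?_
    rw [add_comm]
    exact add_le_add (hη' x) (hχ' x)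

/-- The outer part is bounded uniformly in `R` because in the plane the squared gradient `1/R²`
balances the area of order `R²`. The constants are `2·4²` for the strip and `2·3²` for the ball. -/
lemma integral_norm_fderiv_cutoff_le {φ : Plane → ℝ} (hφ : IsCutoff D φ) (hD : IsOpen D)
    {s R ω B : ℝ} (hR : 0 < R)
    (hφd : ∀ x, ‖fderiv ℝ φ x‖ ≤ (strip D s).indicator (fun _ => 4 / s) x +
        (closedBall (0 : Plane) (3 * R)).indicator (fun _ => 1 / R) x)
    (hvol : volume (strip D s) ≠ ⊤) (hWc : Continuous W)
    (hWB : ∀ x, ‖W x‖ ≤ B) (hWω : ∀ x ∈ strip D s, ‖W x‖ ≤ ω) :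
    ∫ x, ‖fderiv ℝ φ x‖ ^ 2 * ‖W x‖ ^ 2 ≤
      32 * ω ^ 2 / s ^ 2 * volume.real (strip D s) +
        18 * B ^ 2 * volume.real (ball (0 : Plane) 1) := by
  have hms := measurableSet_strip hD s
  have hmb : MeasurableSet (closedBall (0 : Plane) (3 * R)) := isClosed_closedBall.measurableSet
  have hcφ' := hφ.continuous_fderiv.continuousOn (s := D)
  have hcW := hWc.continuousOn (s := D)
  have i1 : Integrable fun x => ‖fderiv ℝ φ x‖ ^ 2 * ‖W x‖ ^ 2 :=
    hφ.integrable hD (by fun_prop) fun x hx => by simp [hφ.fderiv_eq_zero hx]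
  have i2 : Integrable ((strip D s).indicator fun _ => 32 * ω ^ 2 / s ^ 2) :=
    (integrable_indicator_iff hms).2 (integrableOn_const hvol)
  have i3 : Integrable ((closedBall (0 : Plane) (3 * R)).indicator fun _ => 2 * B ^ 2 / R ^ 2) :=
    (integrable_indicator_iff hmb).2 (integrableOn_const measure_closedBall_lt_top.ne)
  have hball : volume.real (closedBall (0 : Plane) (3 * R)) =
      9 * R ^ 2 * volume.real (ball (0 : Plane) 1) := by
    rw [Measure.real, Measure.addHaar_closedBall _ _ (by positivity), ENNReal.toReal_mul,
      ENNReal.toReal_ofReal (by positivity), Measure.real, finrank_euclideanSpace_fin]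
    ring
  calc ∫ x, ‖fderiv ℝ φ x‖ ^ 2 * ‖W x‖ ^ 2
      ≤ ∫ x, ((strip D s).indicator (fun _ => 32 * ω ^ 2 / s ^ 2) x +
        (closedBall (0 : Plane) (3 * R)).indicator (fun _ => 2 * B ^ 2 / R ^ 2) x) := by
        refine integral_mono i1 (i2.add i3) fun x => ?_
        have hd := hφd x
        have hB := hWB x
        have h0 := norm_nonneg (fderiv ℝ φ x)
        by_cases hx : x ∈ strip D s <;> by_cases hxR : x ∈ closedBall (0 : Plane) (3 * R)
        · simp only [indicator_of_mem hx, indicator_of_mem hxR] at hd ⊢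
          have hω := hWω x hx
          calc ‖fderiv ℝ φ x‖ ^ 2 * ‖W x‖ ^ 2 ≤ (4 / s + 1 / R) ^ 2 * ‖W x‖ ^ 2 := by gcongr
            _ ≤ (2 * (4 / s) ^ 2 + 2 * (1 / R) ^ 2) * ‖W x‖ ^ 2 := by
              gcongr
              nlinarith [sq_nonneg (4 / s - 1 / R)]
            _ = 2 * (4 / s) ^ 2 * ‖W x‖ ^ 2 + 2 * (1 / R) ^ 2 * ‖W x‖ ^ 2 := by ring
            _ ≤ 2 * (4 / s) ^ 2 * ω ^ 2 + 2 * (1 / R) ^ 2 * B ^ 2 := by gcongr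
            _ = _ := by ring
        · simp only [indicator_of_mem hx, indicator_of_notMem hxR, add_zero] at hd ⊢
          have hω := hWω x hx
          calc ‖fderiv ℝ φ x‖ ^ 2 * ‖W x‖ ^ 2 ≤ (4 / s) ^ 2 * ω ^ 2 := by gcongr
            _ = 16 * (ω ^ 2 / s ^ 2) := by ring
            _ ≤ 32 * (ω ^ 2 / s ^ 2) := by gcongr; norm_num
            _ = _ := by ring
        · simp only [indicator_of_notMem hx, indicator_of_mem hxR, zero_add] at hd ⊢
          calc ‖fderiv ℝ φ x‖ ^ 2 * ‖W x‖ ^ 2 ≤ (1 / R) ^ 2 * B ^ 2 := by gcongr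
            _ = 1 * (B ^ 2 / R ^ 2) := by ring
            _ ≤ 2 * (B ^ 2 / R ^ 2) := by gcongr; norm_num
            _ = _ := by ring
        · simp only [indicator_of_notMem hx, indicator_of_notMem hxR, zero_add] at hd ⊢
          rw [le_antisymm hd h0]
          simp
    _ = 32 * ω ^ 2 / s ^ 2 * volume.real (strip D s) +
        2 * B ^ 2 / R ^ 2 * volume.real (closedBall (0 : Plane) (3 * R)) := by
        rw [integral_add i2 i3, integral_indicator hms, integral_indicator hmb]
        simp [mul_comm]
    _ = _ := by
        rw [hball]
        field_simp
        ring

lemma volume_strip_ne_top (hK : IsCompact Dᶜ) (hne : Dᶜ.Nonempty) (s : ℝ) :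
    volume (strip D s) ≠ ⊤ := by
  obtain ⟨r, hr⟩ := hK.isBounded.exists_norm_le
  refine ne_top_of_le_ne_top (measure_closedBall_lt_top (x := (0 : Plane)) (r := s + r)).ne
    (measure_mono fun x hx => ?_)
  obtain ⟨z, hz, hxz⟩ := hK.exists_infDist_eq_dist hne x
  have h1 := hx.2
  rw [hxz, dist_eq_norm] at h1
  have h2 := norm_le_norm_add_norm_sub' x z
  have h3 := hr z hz
  rw [mem_closedBall_zero_iff]
  linarith

set_option maxHeartbeats 1000000 in
/-- A bounded weak solution that vanishes continuously at the boundary is zero. -/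
theorem eq_zero_of_weak_solution (hD : IsOpen D) (hK : Bornology.IsBounded Dᶜ) (hne : Dᶜ.Nonempty)
    (hcone : ∀ y ∈ frontier Dᶜ, ∃ (e : Plane) (r : ℝ), 0 < r ∧ HasOutwardCone Dᶜ y e r)
    (ha : IsElliptic a m N) (hk : 0 < k) (hW : ContDiffOn ℝ 1 W D) (hWc : Continuous W) {B : ℝ}
    (hWB : ∀ x, ‖W x‖ ≤ B) (hbd : ∀ ω > 0, ∃ δ > 0, ∀ x ∈ strip D δ, ‖W x‖ ≤ ω)
    (hweak : ∀ ψ, IsAdmissible D ψ →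
      ∫ x, (a (fderiv ℝ W x) (fderiv ℝ ψ x) + k * inner ℝ (W x) (ψ x)) = 0)
    {x₀ : Plane} (hx₀ : x₀ ∈ D) : W x₀ = 0 := by
  have hm := ha.pos
  have hN := ha.nonneg
  have hKc : IsCompact Dᶜ := Metric.isCompact_of_isClosed_isBounded hD.isClosed_compl hK
  set d₀ := infDist x₀ Dᶜ with hd₀def
  have hd₀ : 0 < d₀ := (hD.isClosed_compl.notMem_iff_infDist_pos hne).1 (by simpa using hx₀)
  let θ : ContDiffBump x₀ := ⟨d₀ / 4, d₀ / 2, by positivity, by linarith⟩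
  have hθc : Continuous θ := θ.continuous
  have hθs : ∀ x, θ x ≠ 0 → x ∈ ball x₀ (d₀ / 2) := fun x hx => by
    rw [← θ.support_eq]; exact hx
  have hθd : ∀ x, θ x ≠ 0 → d₀ / 2 ≤ infDist x Dᶜ := fun x hx => by
    have h1 := hθs x hx
    rw [mem_ball, dist_comm] at h1
    have h2 := infDist_le_infDist_add_dist (s := Dᶜ) (x := x₀) (y := x)
    linarith
  set g : Plane → Plane := fun x => θ x • W x with hgdef
  have hg : Continuous g := by fun_prop
  have hgc : HasCompactSupport g := θ.hasCompactSupport.smul_right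
  have hgd : ∀ x, g x ≠ 0 → d₀ / 2 ≤ infDist x Dᶜ := fun x hx =>
    hθd x fun h => hx (by simp [hgdef, h])
  set I := ∫ x, θ x * ‖W x‖ ^ 2 with hI
  obtain ⟨C, hC1, s₀, hs₀, hstrip⟩ :=
    exists_strip_estimates hD hK hne hcone ha hk.le (half_pos hd₀)
  set G := 4 + 4 * (k⁻¹ * ∫ x, ‖g x‖ ^ 2) with hG
  have hG0 : 0 ≤ G := by
    have : 0 ≤ ∫ x, ‖g x‖ ^ 2 := integral_nonneg fun _ => sq_nonneg _
    positivity
  set V := volume.real (ball (0 : Plane) 1) with hV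
  have hV0 : 0 ≤ V := measureReal_nonneg
  set A := 4 * N * (C * (G + 1) + C + 4 * N ^ 2 / m ^ 2 * (32 * C + 18 * B ^ 2 * V) +
    C ^ 2 * (C * G + 1)) with hA
  set Q := 8 * N ^ 3 / m ^ 2 + 2 * N ^ 2 / m + 8 * N with hQ
  have hQ0 : 0 ≤ Q := by positivity
  have hC0 : 0 < C := by linarith
  have key : ∀ ω ∈ Ioc (0 : ℝ) 1, I ≤ (A + 1) * ω := by
    rintro ω ⟨hω, hω1⟩
    obtain ⟨δ, hδ, hWδ⟩ := hbd ω hω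
    -- The bound `C * s ≤ s₀` admits the wider Poincaré strip; `s ≤ ω ^ 2` makes `s²/ω ≤ ωs`, which
    -- tames the outer cutoff term; `s ≤ d₀ / 2` keeps the strip cutoff equal to 1 where `θ` is
    -- nonzero.
    obtain ⟨s, hs, hsC, hsδ, hsω, hsd⟩ :
        ∃ s > 0, C * s ≤ s₀ ∧ s ≤ δ ∧ s ≤ ω ^ 2 ∧ s ≤ d₀ / 2 := by
      refine ⟨min (min (s₀ / C) δ) (min (ω ^ 2) (d₀ / 2)), by positivity, ?_, ?_, ?_, ?_⟩
      · exact (le_div_iff₀' hC0).1 ((min_le_left _ _).trans (min_le_left _ _))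
      · exact (min_le_left _ _).trans (min_le_right _ _)
      · exact (min_le_right _ _).trans (min_le_left _ _)
      · exact (min_le_right _ _).trans (min_le_right _ _)
    have hss : s ≤ C * s := le_mul_of_one_le_left hs.le hC1
    obtain ⟨hvol, hpoin, hgrad⟩ := hstrip s ⟨hs, hss.trans hsC⟩
    obtain ⟨-, -, hgrad'⟩ := hstrip (C * s) ⟨by positivity, hsC⟩
    have hWω : ∀ x ∈ strip D s, ‖W x‖ ≤ ω := fun x hx => hWδ x (strip_mono hsδ hx)
    have hvolfin := volume_strip_ne_top hKc hne s
    set Emax := 32 * C * ω ^ 2 / s + 18 * B ^ 2 * V with hEmax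
    have hEmax0 : 0 ≤ Emax := by positivity
    -- Chosen after `s`: it must compensate the energy bound `Q * Emax` of the test field `φ²W`,
    -- which grows like `1/s`, and not exceed the strip width.
    set ε := min (min 1 s) (ω ^ 2 / (2 * Q * Emax + 1)) with hεdef
    have hε : 0 < ε := by positivity
    have hε1 : ε ≤ 1 := (min_le_left _ _).trans (min_le_left _ _)
    have hεs : ε ≤ s := (min_le_left _ _).trans (min_le_right _ _)
    have hεω : 2 * ε * (Q * Emax) ≤ ω ^ 2 := by
      have := (le_div_iff₀ (by positivity)).1 (min_le_right (min 1 s) (ω ^ 2 / (2 * Q * Emax + 1)))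
      rw [← hεdef] at this
      linarith
    obtain ⟨v, hv⟩ := exists_isNearMinimizer ha hk hg hgc D hε
    have hvE : energy a k v v ≤ G := (hv.energy_le ha hk hg hgc).trans (by rw [hG]; linarith)
    -- The outer radius depends on `v`, hence on `s` and `ε`. This is harmless, since all bounds on
    -- the cutoff terms are uniform in `R`.
    obtain ⟨R, hR2, hRv, hRθ⟩ : ∃ R : ℝ, 2 ≤ R ∧ (∀ x ∈ tsupport v, ‖x‖ < R - 1) ∧
        ∀ x, θ x ≠ 0 → ‖x‖ < R - 1 := by
      obtain ⟨R₁, hR₁⟩ := hv.isAdmissible.hasCompactSupport.isCompact.isBounded.exists_norm_le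
      refine ⟨2 + |R₁| + (‖x₀‖ + d₀ / 2), ?_, fun x hx => ?_, fun x hx => ?_⟩
      · have := abs_nonneg R₁
        have := norm_nonneg x₀
        linarith
      · have := hR₁ x hx
        have := le_abs_self R₁
        have := norm_nonneg x₀
        linarith
      · have h1 := hθs x hx
        rw [mem_ball, dist_eq_norm] at h1
        have := norm_le_norm_add_norm_sub' x x₀
        have := abs_nonneg R₁
        linarith
    obtain ⟨φ, hφ, hφ1, hφ2, hφ3, hφ4⟩ := exists_isCutoff D hs hR2
    set X := ∫ x, φ x ^ 2 * ‖fderiv ℝ W x‖ ^ 2 with hX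
    set Y := ∫ x, φ x ^ 2 * ‖W x‖ ^ 2 with hY
    set E := ∫ x, ‖fderiv ℝ φ x‖ ^ 2 * ‖W x‖ ^ 2 with hE
    have hX0 : 0 ≤ X := integral_nonneg fun _ => by positivity
    have hY0 : 0 ≤ Y := integral_nonneg fun _ => by positivity
    have hEle : E ≤ Emax := by
      refine (integral_norm_fderiv_cutoff_le hφ hD (by linarith) hφ4 hvolfin hWc hWB hWω).trans ?_
      rw [hEmax]
      gcongr
      calc 32 * ω ^ 2 / s ^ 2 * volume.real (strip D s) ≤ 32 * ω ^ 2 / s ^ 2 * (C * s) := by gcongr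
        _ = _ := by field_simp
    have hcac := hφ.caccioppoli hD ha hW hweak
    have hXE : X ≤ 4 * N ^ 2 / m ^ 2 * E := by
      have h1 : m / 2 * X ≤ 2 * N ^ 2 / m * E := by
        have : 0 ≤ k * Y := by positivity
        linarith
      calc X = 2 / m * (m / 2 * X) := by field_simp
        _ ≤ 2 / m * (2 * N ^ 2 / m * E) := by gcongr
        _ = _ := by field_simp; ring
    have hYE : k * Y ≤ 2 * N ^ 2 / m * E := by
      have : 0 ≤ m / 2 * X := by positivity
      linarith
    have hψ := hφ.isAdmissible_sq_smul hD hW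
    have hψE : energy a k (fun x => φ x ^ 2 • W x) (fun x => φ x ^ 2 • W x) ≤ Q * Emax := by
      refine (hφ.energy_sq_smul_le hD ha hk.le hW).trans ?_
      calc 2 * N * X + k * Y + 8 * N * E
          ≤ 2 * N * (4 * N ^ 2 / m ^ 2 * E) + 2 * N ^ 2 / m * E + 8 * N * E := by gcongr
        _ = Q * E := by rw [hQ]; ring
        _ ≤ Q * Emax := by gcongr
    have hgψ : ∫ x, (inner ℝ (g x) (φ x ^ 2 • W x) : ℝ) = I := by
      rw [hI]
      congr 1
      funext x
      by_cases hx : θ x = 0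
      · simp [hgdef, hx]
      · rw [hφ1 x (hsd.trans (hθd x hx)) (hRθ x hx)]
        simp [hgdef, inner_smul_left]
    have hsq := hv.sq_le ha hg hψ
    rw [hgψ] at hsq
    have hdiff : |energy a k v (fun x => φ x ^ 2 • W x) - I| ≤ ω := by
      refine abs_le_of_sq_le_sq (hsq.trans (le_trans ?_ hεω)) hω.le
      gcongr
    -- The weight balances the two errors: `τ ∫ φ²|∇W|²` is of order `ωs` because the integral is
    -- `O(ω²/s + 1)`, and `τ⁻¹ · O(s³)` is of order `ωs` as well. The prefactor `1/s` then leaves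
    -- `O(ω)`.
    have hpair := hφ.abs_energy_pairing_le (τ := s ^ 2 / ω) hD ha hW hv.isAdmissible hweak hs
      (by positivity) hvolfin hWω (fun x hx => hφ2 x (hRv x hx))
      (fun x hx hxs => hφ3 x (hRv x hx) hxs)
    have hP : ∫ x in strip D s, ‖fderiv ℝ v x‖ ^ 2 ≤ C * (G + 1) * s := by
      refine (hgrad g v ε hg hgd hε.le hv).trans ?_
      calc C * (s * energy a k v v + ε) ≤ C * (s * G + s) := by gcongr
        _ = _ := by ring
    have hZ : ∫ x in strip D s, ‖v x‖ ^ 2 ≤ C ^ 2 * (C * G + 1) * s ^ 3 := by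
      refine (hpoin v hv.isAdmissible).trans ?_
      calc C * s ^ 2 * ∫ x in strip D (C * s), ‖fderiv ℝ v x‖ ^ 2
          ≤ C * s ^ 2 * (C * (C * s * energy a k v v + ε)) := by
            gcongr
            exact hgrad' g v ε hg hgd hε.le hv
        _ ≤ C * s ^ 2 * (C * (C * s * G + s)) := by gcongr
        _ = _ := by ring
    have hτX : s ^ 2 / ω * X ≤ 4 * N ^ 2 / m ^ 2 * (32 * C + 18 * B ^ 2 * V) * ω * s := by
      have h1 : s ^ 2 / ω ≤ ω * s := by
        rw [div_le_iff₀ hω]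
        nlinarith
      calc s ^ 2 / ω * X ≤ s ^ 2 / ω * (4 * N ^ 2 / m ^ 2 * Emax) := by
            gcongr
            exact hXE.trans (by gcongr)
        _ = 4 * N ^ 2 / m ^ 2 * (32 * C * ω * s + 18 * B ^ 2 * V * (s ^ 2 / ω)) := by
            rw [hEmax]; field_simp
        _ ≤ 4 * N ^ 2 / m ^ 2 * (32 * C * ω * s + 18 * B ^ 2 * V * (ω * s)) := by gcongr
        _ = _ := by ring
    have hbound : |energy a k v (fun x => φ x ^ 2 • W x)| ≤ A * ω := by
      refine hpair.trans ?_
      calc _ ≤ 4 * N / s * (ω * (C * (G + 1) * s + C * s) +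
            (4 * N ^ 2 / m ^ 2 * (32 * C + 18 * B ^ 2 * V) * ω * s +
              (s ^ 2 / ω)⁻¹ * (C ^ 2 * (C * G + 1) * s ^ 3))) := by gcongr
        _ = A * ω := by
            rw [hA]
            field_simp
            ring
    have h1 := (abs_le.1 hdiff).1
    have h2 := (abs_le.1 hbound).2
    linarith
  have hA0 : 0 < A + 1 := by positivity
  have hI0 : I ≤ 0 := by
    refine le_of_forall_pos_le_add fun t ht => ?_
    have h1 := key (min 1 (t / (A + 1))) ⟨by positivity, min_le_left _ _⟩
    have h2 : (A + 1) * min 1 (t / (A + 1)) ≤ t :=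
      (mul_le_mul_of_nonneg_left (min_le_right _ _) hA0.le).trans (by field_simp; exact le_rfl)
    linarith
  by_contra hWx
  have hpos : 0 < I := by
    refine Continuous.integral_pos_of_hasCompactSupport_nonneg_nonzero (x := x₀) (by fun_prop)
      θ.hasCompactSupport.mul_right (fun x => mul_nonneg θ.nonneg (sq_nonneg _)) ?_
    have : θ x₀ = 1 := θ.one_of_mem_closedBall (mem_closedBall_self (by positivity))
    rw [this, one_mul]
    exact pow_ne_zero 2 (norm_ne_zero_iff.2 hWx)
  linarith

end Uniqueness

/-! ### The exterior Dirichlet problem -/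

section Exterior

variable {D : Set Plane}

/-- Needed because `infDist` to the empty set is 0 by convention, which would make every strip all
of `D`. -/
lemma IsExteriorDomain.nonempty_compl (hD : IsExteriorDomain D) : Dᶜ.Nonempty :=
  hD.isSimplyConnected_compl.isPathConnected.nonempty

lemma HasC2Boundary.exists_hasOutwardCone (hD : HasC2Boundary D) {y : Plane}
    (hy : y ∈ frontier Dᶜ) : ∃ (e : Plane) (r : ℝ), 0 < r ∧ HasOutwardCone Dᶜ y e r := by
  rw [frontier_compl] at hy
  obtain ⟨U, ψ, hU, hyU, hψ, hψ0, hDU⟩ := hD y hy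
  exact exists_hasOutwardCone_of_hasStrictFDerivAt hU hyU
    ((hψ.contDiffAt (hU.mem_nhds hyU)).hasStrictFDerivAt (by norm_num)) hψ0 hDU

/-- The homogeneous stationary problem has only the trivial solution. -/
theorem eqOn_of_lameOperator_eq {lam mu rho kappa : ℝ} (hrho : 0 < rho) (hmu : 0 < mu)
    (hlam : 0 < lam + 2 * mu) (hkappa : 0 < kappa) (hD : IsExteriorDomain D) {u v : Plane → Plane}
    (hu : ContDiffOn ℝ 2 u D) (hv : ContDiffOn ℝ 2 v D)
    (huc : ContinuousOn u (closure D)) (hvc : ContinuousOn v (closure D))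
    (heq : ∀ x ∈ D, lameOperator lam mu rho u x - kappa ^ 2 • u x =
      lameOperator lam mu rho v x - kappa ^ 2 • v x)
    (hbdry : ∀ x ∈ frontier D, u x = v x)
    (hu0 : Tendsto u (Bornology.cobounded Plane ⊓ 𝓟 D) (𝓝 0))
    (hv0 : Tendsto v (Bornology.cobounded Plane ⊓ 𝓟 D) (𝓝 0)) : EqOn u v (closure D) := by
  have hDo := hD.isOpen
  have hne := hD.nonempty_compl
  have hKc : IsCompact Dᶜ :=
    Metric.isCompact_of_isClosed_isBounded hDo.isClosed_compl hD.isBounded_compl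
  set W : Plane → Plane := D.indicator fun x => u x - v x with hWdef
  have hWD : ∀ x ∈ D, W x = u x - v x := fun x hx => indicator_of_mem hx _
  have hW0 : ∀ x, x ∉ D → W x = 0 := fun x hx => indicator_of_notMem hx _
  have hWc : Continuous W :=
    continuous_indicator (fun x hx => sub_eq_zero.2 (hbdry x hx)) (huc.sub hvc)
  have hWd : ContDiffOn ℝ 2 W D := (hu.sub hv).congr hWD
  have hWlim : Tendsto W (cocompact Plane) (𝓝 0) := by
    have hDmem : D ∈ Bornology.cobounded Plane := by
      rw [← Bornology.isCobounded_def, ← Bornology.isBounded_compl_iff]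
      exact hD.isBounded_compl
    have h1 := hu0.sub hv0
    rw [inf_of_le_left (le_principal_iff.2 hDmem), sub_zero] at h1
    rw [← Metric.cobounded_eq_cocompact]
    refine h1.congr' ?_
    filter_upwards [hDmem] with x hx
    exact (hWD x hx).symm
  obtain ⟨B, hB⟩ : ∃ B, ∀ x, ‖W x‖ ≤ B := by
    let W₀ : ZeroAtInftyContinuousMap Plane Plane := ⟨⟨W, hWc⟩, hWlim⟩
    exact ⟨‖W₀.toBCF‖, fun x => W₀.toBCF.norm_coe_le_norm x⟩
  -- Decay at infinity gives uniform continuity on the plane. As `W` vanishes on `Dᶜ`, it is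
  -- therefore uniformly small in thin strips.
  have hWu : UniformContinuous W := hWc.uniformContinuous_of_tendsto_cocompact hWlim
  have hbd : ∀ ω > 0, ∃ δ > 0, ∀ x ∈ strip D δ, ‖W x‖ ≤ ω := fun ω hω => by
    obtain ⟨δ, hδ, h⟩ := Metric.uniformContinuous_iff.1 hWu ω hω
    refine ⟨δ / 2, by positivity, fun x hx => ?_⟩
    obtain ⟨z, hz, hxz⟩ := hKc.exists_infDist_eq_dist hne x
    have h1 := hx.2
    rw [hxz] at h1
    have h2 := h (show dist x z < δ by linarith)
    rw [hW0 z hz, dist_zero_right] at h2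
    exact h2.le
  have hWeq : ∀ x ∈ D, lameOperator lam mu rho W x = kappa ^ 2 • W x := fun x hx => by
    have hx' := hDo.mem_nhds hx
    rw [lameOperator_congr lam mu rho (hu.contDiffAt hx') (hv.contDiffAt hx')
      (by filter_upwards [hx'] with y hy using hWD y hy), hWD x hx, smul_sub, sub_eq_sub_iff_sub_eq_sub]
    exact heq x hx
  have hs : 0 < shearVelocity mu rho ^ 2 := by
    have : 0 < √(mu / rho) := Real.sqrt_pos.2 (by positivity)
    exact pow_pos this 2
  have hp : 0 < pressureVelocity lam mu rho ^ 2 := by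
    have : 0 < √((lam + 2 * mu) / rho) := Real.sqrt_pos.2 (by positivity)
    exact pow_pos this 2
  have ha := isElliptic_lameForm (lt_min hs hp) (min_le_left _ _) (min_le_right _ _)
  have hzero : ∀ x ∈ D, W x = 0 := fun x hx =>
    eq_zero_of_weak_solution hDo hD.isBounded_compl hne
      (fun y hy => hD.hasC2Boundary.exists_hasOutwardCone hy) ha (pow_pos hkappa 2)
      (hWd.of_le (by norm_num)) hWc hB hbd
      (fun ψ hψ => integral_lameForm_eq_zero hDo hWd hWeq hψ) hx
  intro x hx
  by_cases hxD : x ∈ D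
  · have := hzero x hxD
    rw [hWD x hxD] at this
    exact sub_eq_zero.1 this
  · exact hbdry x ⟨hx, fun h => hxD (interior_subset h)⟩

end Exterior

end Elastodynamics

end

/-- Strong induction: the right-hand side at level `n` involves only earlier fields, which already
agree in `D`, so each step is uniqueness for a single stationary problem. -/
theorem theorem2p1 (lam mu rho kappa : ℝ) (hrho : 0 < rho) (hmu : 0 < mu)
    (hlam : 0 < lam + 2 * mu) (hkappa : 0 < kappa)
    (D : Set Elastodynamics.Plane) (hD : Elastodynamics.IsExteriorDomain D)
    (f u v : ℕ → Elastodynamics.Plane → Elastodynamics.Plane)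
    (hu : Elastodynamics.IsSolution lam mu rho kappa D f u)
    (hv : Elastodynamics.IsSolution lam mu rho kappa D f v) :
    ∀ n, Set.EqOn (u n) (v n) (closure D) := by
  intro n
  induction n using Nat.strong_induction_on with
  | _ n ih =>
    refine Elastodynamics.eqOn_of_lameOperator_eq hrho hmu hlam hkappa hD (hu.contDiffOn n)
      (hv.contDiffOn n) (hu.continuousOn n) (hv.continuousOn n) (fun x hx => ?_)
      (fun x hx => (hu.boundary n x hx).trans (hv.boundary n x hx).symm)
      (hu.tendsto_zero n) (hv.tendsto_zero n)
    rw [hu.equation n x hx, hv.equation n x hx]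
    exact Finset.sum_congr rfl fun m hm => by
      rw [ih m (Finset.mem_range.1 hm) (subset_closure hx)]
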